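/- For an operator $T$ on a Hilbert space let $\mathcal K(T)$ and $\mathcal R(T)$ be the projections onto $\ker T$ and onto the closure of the range of $T$. An element of a $*$-ring is $*$-clean if it is the sum of an invertible element and a projection (self-adjoint idempotent) of the ring, and a $*$-ring is $*$-clean if all its elements are. (1) Let $\mathfrak A$ be a finite von Neumann algebra acting on a Hilbert space $\mathcal H$, and let $T\in\mathfrak A$ have closed range. Then $T$ is $*$-clean in $\mathfrak A$. More precisely, put $E=I-\mathcal K(T)$ and $F=\mathcal R(T)$. Then there are a decomposition of $I$ into mutually orthogonal projections of $\mathfrak A$ and, in $\mathfrak A$, partial isometries identifying the two diagonal corners of the second summand with each other, and likewise those of the third summand, with respect to which $$E=I_1\oplus\begin{pmatrix}I_2&0\\0&0\end{pmatrix}\oplus\begin{pmatrix}I_3&0\\0&0\end{pmatrix}\oplus 0,\qquad F=I_1\oplus\begin{pmatrix}0&0\\0&I_2\end{pmatrix}\oplus\begin{pmatrix}H&\sqrt{H(I_3-H)}\\\sqrt{H(I_3-H)}&I_3-H\end{pmatrix}\oplus 0,$$ where $H\in\mathfrak A$, $0\le H\le I_3$ and $\ker H=\ker(I_3-H)=\{0\}$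 in the range of $I_3$ (any of the summands may be zero). For every such decomposition, the operator $$P=0\oplus\begin{pmatrix}\frac12I_2&\frac12I_2\\\frac12I_2&\frac12I_2\end{pmatrix}\oplus\begin{pmatrix}\frac12I_3&\frac i2I_3\\-\frac i2I_3&\frac12I_3\end{pmatrix}\oplus I_4$$ is a projection in $\mathfrak A$ and $T-P$ is invertible in $\mathfrak A$. (2) Let $\mathfrak A_1,\dots,\mathfrak A_m$ be von Neumann algebras such that $\mathfrak A_k$ is of type $I_{n_k}$ with $1\le n_k<\infty$ (that is, its identity is the sum of $n_k$ mutually orthogonal equivalent abelian projections). Then the direct sum $\mathfrak A_1\oplus\cdots\oplus\mathfrak A_m$ is $*$-clean. -/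

import Mathlib

noncomputable section

/-! ### Notions for `*`-rings -/

section StarRingNotions

variable {R : Type*} [Ring R] [StarRing R]

/-- An element of a `*`-ring is `*`-clean if it is the sum of an invertible element and a
projection (a self-adjoint idempotent). -/
def IsStarCleanElem (a : R) : Prop :=
  ∃ u p : R, IsUnit u ∧ IsStarProjection p ∧ a = u + p

variable (R) in
/-- A `*`-ring is `*`-clean if all its elements are. -/
def IsStarCleanRing : Prop := ∀ a : R, IsStarCleanElem a

/-- Murray-von Neumann equivalence of the projections `p` and `q`. -/
def MvNEquiv (p q : R) : Prop := ∃ v : R, star v * v = p ∧ v * star v = q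

/-- A projection is finite if it is not equivalent to a proper subprojection of itself. -/
def IsFiniteProj (p : R) : Prop :=
  IsStarProjection p ∧ ∀ q : R, IsStarProjection q → p * q = q → MvNEquiv p q → q = p

/-- A projection `p` is abelian if the corner `pRp` is commutative. -/
def IsAbelianProj (p : R) : Prop :=
  IsStarProjection p ∧ ∀ a b : R, (p * a * p) * (p * b * p) = (p * b * p) * (p * a * p)

end StarRingNotions

namespace VonNeumannAlgebra

/-! ### Finite algebras, algebras of type `I_n` -/

section Types

variable {H : Type*} [NormedAddCommGroup H] [InnerProductSpace ℂ H] [CompleteSpace H]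

/-- A von Neumann algebra is finite if its identity is a finite projection. -/
def IsFiniteAlg (A : VonNeumannAlgebra H) : Prop := IsFiniteProj (1 : A)

/-- A von Neumann algebra is of type `I_n` (`n` a positive integer) if its identity is the sum of
`n` mutually orthogonal equivalent abelian projections. -/
def IsTypeI (A : VonNeumannAlgebra H) (n : ℕ) : Prop :=
  1 ≤ n ∧ ∃ p : Fin n → A, (∀ i, IsAbelianProj (p i)) ∧ (∀ i j, i ≠ j → p i * p j = 0) ∧
    (∀ i j, MvNEquiv (p i) (p j)) ∧ ∑ i, p i = 1

end Types

/-! ### Finite direct sums -/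

section DirectSum

variable {ι : Type*} [Fintype ι] {H : ι → Type*} [∀ i, NormedAddCommGroup (H i)]
  [∀ i, InnerProductSpace ℂ (H i)] [∀ i, CompleteSpace (H i)]

/-- The operator `⊕ tᵢ` on the Hilbert space direct sum `⊕ Hᵢ`. -/
def blockDiag (t : ∀ i, H i →L[ℂ] H i) : PiLp 2 H →L[ℂ] PiLp 2 H :=
  ((PiLp.continuousLinearEquiv 2 ℂ H).symm : (∀ i, H i) →L[ℂ] PiLp 2 H) ∘L
    ContinuousLinearMap.pi (fun i => t i ∘L PiLp.proj 2 H i)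

@[simp]
theorem blockDiag_apply (t : ∀ i, H i →L[ℂ] H i) (x : PiLp 2 H) (i : ι) :
    blockDiag t x i = t i (x i) := rfl

theorem star_blockDiag (t : ∀ i, H i →L[ℂ] H i) :
    star (blockDiag t) = blockDiag (fun i => star (t i)) := by
  symm
  rw [ContinuousLinearMap.star_eq_adjoint, ContinuousLinearMap.eq_adjoint_iff]
  intro x y
  simp [PiLp.inner_apply, ContinuousLinearMap.star_eq_adjoint,
    ContinuousLinearMap.adjoint_inner_left]

theorem exists_blockDiag_iff (A : ∀ i, VonNeumannAlgebra (H i)) (T : PiLp 2 H →L[ℂ] PiLp 2 H) :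
    (∃ t : ∀ i, H i →L[ℂ] H i, (∀ i, t i ∈ A i) ∧ T = blockDiag t) ↔
      T ∈ Set.centralizer {S | ∃ s : ∀ i, H i →L[ℂ] H i,
        (∀ i, s i ∈ (A i).commutant) ∧ S = blockDiag s} := by
  classical
  constructor
  · rintro ⟨t, ht, rfl⟩ S ⟨s, hs, rfl⟩
    ext x i
    have h := mem_commutant_iff.1 (hs i) (t i) (ht i)
    simpa using (congrArg (fun f => f (x i)) h).symm
  · intro hT
    let E : ∀ i, H i →L[ℂ] PiLp 2 H := fun i =>
      ((PiLp.continuousLinearEquiv 2 ℂ H).symm : (∀ i, H i) →L[ℂ] PiLp 2 H) ∘L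
        ContinuousLinearMap.single ℂ H i
    have hE : ∀ (i : ι) (s : H i →L[ℂ] H i) (x : PiLp 2 H),
        blockDiag (Pi.single i s) x = E i (s (x i)) := by
      intro i s x
      ext j
      by_cases hj : j = i
      · subst hj; simp [E]
      · simp [E, hj]
    have hEi : ∀ (i : ι) (y : H i), E i y i = y := fun i y => by simp [E]
    have hcomm : ∀ (i : ι) (s : H i →L[ℂ] H i), s ∈ (A i).commutant → ∀ x : PiLp 2 H,
        E i (s (T x i)) = T (E i (s (x i))) := by
      intro i s hs x
      have h := hT (blockDiag (Pi.single i s)) ⟨Pi.single i s, fun j => by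
        by_cases hj : j = i
        · subst hj; simpa using hs
        · simp [hj, zero_mem], rfl⟩
      have h2 := congrArg (fun f => f x) h
      simpa [hE] using h2
    refine ⟨fun i => PiLp.proj 2 H i ∘L T ∘L E i, fun i => ?_, ?_⟩
    · rw [← commutant_commutant (A i), mem_commutant_iff]
      intro s hs
      ext y
      have h := congrArg (fun z : PiLp 2 H => z i) (hcomm i s hs (E i y))
      simpa [hEi] using h
    · ext x i
      have h := congrArg (fun z : PiLp 2 H => z i) (hcomm i 1 (one_mem _) x)
      simpa [hEi] using h

/-- The direct sum of finitely many von Neumann algebras `Aᵢ` on `Hᵢ`: all the operators `⊕ tᵢ`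
with `tᵢ ∈ Aᵢ`, acting on the Hilbert space direct sum `⊕ Hᵢ`. -/
def directSum (A : ∀ i, VonNeumannAlgebra (H i)) : VonNeumannAlgebra (PiLp 2 H) where
  carrier := {T | ∃ t : ∀ i, H i →L[ℂ] H i, (∀ i, t i ∈ A i) ∧ T = blockDiag t}
  mul_mem' := by
    rintro _ _ ⟨s, hs, rfl⟩ ⟨t, ht, rfl⟩
    exact ⟨fun i => s i * t i, fun i => mul_mem (hs i) (ht i), by ext; simp⟩
  add_mem' := by
    rintro _ _ ⟨s, hs, rfl⟩ ⟨t, ht, rfl⟩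
    exact ⟨fun i => s i + t i, fun i => add_mem (hs i) (ht i), by ext; simp⟩
  algebraMap_mem' := fun c =>
    ⟨fun i => algebraMap ℂ _ c, fun i => (A i).algebraMap_mem' c, by
      ext; simp [Algebra.algebraMap_eq_smul_one]⟩
  star_mem' := by
    rintro _ ⟨t, ht, rfl⟩
    exact ⟨fun i => star (t i), fun i => star_mem (ht i), star_blockDiag t⟩
  centralizer_centralizer' := by
    have h : {T | ∃ t : ∀ i, H i →L[ℂ] H i, (∀ i, t i ∈ A i) ∧ T = blockDiag t} =
        Set.centralizer {S | ∃ s : ∀ i, H i →L[ℂ] H i,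
          (∀ i, s i ∈ (A i).commutant) ∧ S = blockDiag s} :=
      Set.ext (exists_blockDiag_iff A)
    change Set.centralizer (Set.centralizer {T | _}) = {T | _}
    rw [h, Set.centralizer_centralizer_centralizer]

end DirectSum

/-! ### Kernel and range projections, and the normal form of two projections -/

section TwoProjections

variable {H : Type*} [NormedAddCommGroup H] [InnerProductSpace ℂ H] [CompleteSpace H]

/-- `𝒦(T)`: the projection onto the kernel of `T`. -/
def kerProj (T : H →L[ℂ] H) : H →L[ℂ] H := T.ker.starProjection

/-- `ℛ(T)`: the projection onto the closure of the range of `T`. -/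
def rangeProj (T : H →L[ℂ] H) : H →L[ℂ] H := T.range.topologicalClosure.starProjection

/-- A normal form, inside the von Neumann algebra `A`, of the two projections `E`, `F`:
`1` is decomposed as `p₁ + (p₂ + v₂v₂*) + (p₃ + v₃v₃*) + p₄`, where `v₂`, `v₃` are partial
isometries with initial projections `p₂`, `p₃`, which identify the two diagonal corners of the
second and of the third summand, and with respect to this decomposition
`E = I₁ ⊕ [I₂, 0; 0, 0] ⊕ [I₃, 0; 0, 0] ⊕ 0` and
`F = I₁ ⊕ [0, 0; 0, I₂] ⊕ [h, √(h(I₃-h)); √(h(I₃-h)), I₃-h] ⊕ 0`,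
where `0 ≤ h ≤ I₃` and `h`, `I₃ - h` are injective on the range of `p₃`.
(Projections that sum to `1` are mutually orthogonal.) -/
structure TwoProjForm (A : VonNeumannAlgebra H) (E F : H →L[ℂ] H) where
  (p₁ p₂ p₃ p₄ v₂ v₃ h : H →L[ℂ] H)
  p₁_mem : p₁ ∈ A
  p₂_mem : p₂ ∈ A
  p₃_mem : p₃ ∈ A
  p₄_mem : p₄ ∈ A
  v₂_mem : v₂ ∈ A
  v₃_mem : v₃ ∈ A
  h_mem : h ∈ A
  p₁_proj : IsStarProjection p₁
  p₂_proj : IsStarProjection p₂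
  p₃_proj : IsStarProjection p₃
  p₄_proj : IsStarProjection p₄
  v₂_init : star v₂ * v₂ = p₂
  v₃_init : star v₃ * v₃ = p₃
  sum_eq_one : p₁ + (p₂ + v₂ * star v₂) + (p₃ + v₃ * star v₃) + p₄ = 1
  h_nonneg : 0 ≤ h
  h_le : h ≤ p₃
  h_inj : ∀ x : H, p₃ x = x → h x = 0 → x = 0
  one_sub_h_inj : ∀ x : H, p₃ x = x → (p₃ - h) x = 0 → x = 0
  E_eq : E = p₁ + p₂ + p₃
  F_eq : F = p₁ + v₂ * star v₂ +
    (h + CFC.sqrt (h * (p₃ - h)) * star v₃ + v₃ * CFC.sqrt (h * (p₃ - h)) +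
      v₃ * (p₃ - h) * star v₃)

/-- The operator `0 ⊕ [I₂/2, I₂/2; I₂/2, I₂/2] ⊕ [I₃/2, (i/2)I₃; -(i/2)I₃, I₃/2] ⊕ I₄`
attached to a normal form of two projections. -/
def TwoProjForm.P {A : VonNeumannAlgebra H} {E F : H →L[ℂ] H} (D : TwoProjForm A E F) :
    H →L[ℂ] H :=
  (1 / 2 : ℂ) • (D.p₂ + star D.v₂ + D.v₂ + D.v₂ * star D.v₂) +
    (1 / 2 : ℂ) • (D.p₃ + Complex.I • star D.v₃ - Complex.I • D.v₃ + D.v₃ * star D.v₃) +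
    D.p₄

end TwoProjections

end VonNeumannAlgebra

end

/-! Closed range. Put `E = 1 - kerProj T` and `F = rangeProj T`. If `P` is idempotent and both `E -
P` and `F - P` are invertible, then so is `T - P` (`isUnit_sub_of_isUnit`): closedness of the range
makes `T` map onto the range of `F`, and the rest is linear algebra. In a normal form of `E` and `F`
the operators `E - P` and `F - P` are `1` on the first summand, `-1` on the last, and of the form
`[a, b; c, -a]` with square `1/2` on the other two, so each is invertible. The imaginary
off-diagonal entries of `P` in the third summand cancel the cross terms with the real entry
`√(h(1-h))` of `F`.

Existence of a normal form. The polar decomposition of `(1 - E)FE` isolates the generic part of the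
pair and yields `v₃`; the remainders of `E` and of `1 - E` commute with `F`
(`exists_twoProj_decomposition`). There remains the equivalence of `p₂ = E ∧ (1 - F)` and `q₂ = (1 -
E) ∧ F`. The polar decomposition of `T` gives `E ∼ F` and that of `FE` gives `E - p₂ ∼ F - q₂`;
equivalent projections cancel in a finite algebra (`exists_mvn_of_sub`), hence `p₂ ∼ q₂`.

Type `I_n`. The algebra consists of `n × n` matrices over its centre. A character of the centre
turns `T` into a scalar matrix, which is `*`-clean by the first part. The scalar decomposition lifts
through the matrix units, and its invertible part stays invertible under small perturbations, so `T`
is `*`-clean on a central projection at which the character is `1`. The character space is compact,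
so finitely many such projections suffice, and they are glued together. -/

noncomputable section

open scoped InnerProductSpace

namespace VonNeumannAlgebra

/-! ### Polar decomposition inside a von Neumann algebra. -/

section Polar

variable {H : Type*} [NormedAddCommGroup H] [InnerProductSpace ℂ H] [CompleteSpace H]

theorem mem_of_forall_commute {A : VonNeumannAlgebra H} {T : H →L[ℂ] H}
    (h : ∀ S ∈ A.commutant, ∀ x, S (T x) = T (S x)) : T ∈ A := by
  rw [← commutant_commutant A, mem_commutant_iff]
  intro S hS
  ext x
  exact h S hS x

theorem commute_apply {A : VonNeumannAlgebra H} {S T : H →L[ℂ] H} (hS : S ∈ A.commutant)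
    (hT : T ∈ A) (x : H) : S (T x) = T (S x) :=
  (congrArg (fun f : H →L[ℂ] H => f x) (mem_commutant_iff.1 hS T hT)).symm

theorem smul_mem' (A : VonNeumannAlgebra H) (c : ℂ) {T : H →L[ℂ] H} (hT : T ∈ A) : c • T ∈ A :=
  A.toStarSubalgebra.smul_mem hT c

theorem abs_mem {A : VonNeumannAlgebra H} {X : H →L[ℂ] H} (hX : X ∈ A) : CFC.abs X ∈ A := by
  rw [← commutant_commutant A, mem_commutant_iff]
  intro S hS
  have h := mem_commutant_iff.1 hS
  exact (Commute.cfcAbs_right (show Commute X S from h X hX)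
    (show Commute X (star S) from mem_commutant_iff.1 (star_mem hS) X hX)).eq

theorem starProjection_mem {A : VonNeumannAlgebra H} {K : Submodule ℂ H}
    [K.HasOrthogonalProjection] (h : ∀ S ∈ A.commutant, ∀ x ∈ K, S x ∈ K) :
    K.starProjection ∈ A := by
  rw [IsStarProjection.mem_iff (isStarProjection_starProjection)]
  intro S hS x hx
  simp only [Submodule.range_starProjection, Submodule.mem_comap] at hx ⊢
  exact h S hS x hx

theorem norm_abs_apply (X : H →L[ℂ] H) (x : H) : ‖CFC.abs X x‖ = ‖X x‖ := by
  have h : ⟪CFC.abs X x, CFC.abs X x⟫_ℂ = ⟪X x, X x⟫_ℂ := by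
    rw [← ContinuousLinearMap.adjoint_inner_left, ← ContinuousLinearMap.adjoint_inner_left,
      ← ContinuousLinearMap.star_eq_adjoint, ← ContinuousLinearMap.star_eq_adjoint,
      (CFC.abs_nonneg X).isSelfAdjoint.star_eq, ← mul_apply_eq_comp,
      CFC.abs_mul_abs]
    rfl
  rw [inner_self_eq_norm_sq_to_K, inner_self_eq_norm_sq_to_K] at h
  have h2 : ‖CFC.abs X x‖ ^ 2 = ‖X x‖ ^ 2 := by exact_mod_cast h
  exact (sq_eq_sq₀ (norm_nonneg _) (norm_nonneg _)).1 h2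

/-- Since `‖|X|y‖ = ‖Xy‖`, the map `|X|y ↦ Xy` extends to an isometry on the closure `K` of the
range of `|X|`; composed with the projection onto `K` it is `v`. It lies in `A` because elements of
the commutant commute with `X`, `|X|` and the projection onto `K`. The two kernel clauses are the
form in which support and range projections are used later. -/
theorem exists_polar {A : VonNeumannAlgebra H} {X : H →L[ℂ] H} (hX : X ∈ A) :
    ∃ v ∈ A, X = v * CFC.abs X ∧ IsStarProjection (star v * v) ∧ (∀ x, X x = 0 ↔ v x = 0) ∧
      ∀ x, star X x = 0 ↔ star v x = 0 := by
  set B := CFC.abs X with hB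
  have hBA : B ∈ A := abs_mem hX
  have hBs : star B = B := (CFC.abs_nonneg X).isSelfAdjoint.star_eq
  have hBn : ∀ x, ‖B x‖ = ‖X x‖ := norm_abs_apply X
  let K : Submodule ℂ H := B.range.topologicalClosure
  have hBK : ∀ x, B x ∈ K := fun x => B.range.le_topologicalClosure ⟨x, rfl⟩
  -- Density: a closed condition that holds on the range of `|X|` holds on `K`.
  have hKind : ∀ s : Set H, IsClosed s → (∀ y, B y ∈ s) → ∀ k ∈ K, k ∈ s := by
    intro s hs hB k hk
    have : closure (Set.range B) ⊆ s := closure_minimal (by rintro _ ⟨y, rfl⟩; exact hB y) hs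
    exact this hk
  let e : H →ₗ[ℂ] K := (B : H →ₗ[ℂ] H).codRestrict K hBK
  have he : DenseRange e := by
    intro k
    rw [closure_subtype]
    refine closure_mono ?_ k.2
    rintro _ ⟨y, rfl⟩
    exact ⟨e y, ⟨y, rfl⟩, rfl⟩
  let W : K →L[ℂ] H := (X : H →ₗ[ℂ] H).extendOfNorm e
  have hW : ∀ y, W (e y) = X y := LinearMap.extendOfNorm_eq he ⟨1, fun x => by
    rw [one_mul]; exact (hBn x).ge⟩
  have hWn : ∀ k, ‖W k‖ = ‖k‖ := by
    intro k
    refine he.induction_on k (isClosed_eq (by fun_prop) (by fun_prop)) fun y => ?_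
    rw [hW]
    exact (hBn y).symm
  let W' : K →ₗᵢ[ℂ] H := ⟨W, hWn⟩
  let v : H →L[ℂ] H := W ∘L K.orthogonalProjectionOnto
  have hvB : ∀ y, v (B y) = X y := by
    intro y
    have : K.orthogonalProjectionOnto (B y) = e y :=
      Submodule.orthogonalProjectionOnto_mem_subspace_eq_self (⟨B y, hBK y⟩ : K)
    simp only [v, ContinuousLinearMap.comp_apply, this, hW]
  have hvv : star v * v = K.starProjection := by
    ext x
    refine ext_inner_right ℂ fun y => ?_
    rw [mul_apply_eq_comp, ContinuousLinearMap.star_eq_adjoint,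
      ContinuousLinearMap.adjoint_inner_left]
    have h := W'.inner_map_map (K.orthogonalProjectionOnto x) (K.orthogonalProjectionOnto y)
    have h2 : ⟪v x, v y⟫_ℂ = ⟪K.orthogonalProjectionOnto x, K.orthogonalProjectionOnto y⟫_ℂ := h
    rw [h2, Submodule.coe_inner]
    change ⟪K.starProjection x, K.starProjection y⟫_ℂ = _
    rw [← Submodule.inner_starProjection_left_eq_right]
    congr 1
    exact Submodule.starProjection_eq_self_iff.2 (Submodule.starProjection_apply_mem _ _)
  have hker : ∀ x, X x = 0 ↔ v x = 0 := by
    intro x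
    have h1 : v x = 0 ↔ x ∈ Kᗮ := by
      rw [← norm_eq_zero]
      change ‖W _‖ = 0 ↔ _
      rw [hWn, norm_eq_zero]
      exact Submodule.orthogonalProjectionOnto_eq_zero_iff
    rw [h1, ← norm_eq_zero, ← hBn, norm_eq_zero, Submodule.mem_orthogonal]
    constructor
    · intro hx k hk
      refine hKind {k | ⟪k, x⟫_ℂ = 0} (isClosed_eq (by fun_prop) (by fun_prop)) (fun y => ?_) k hk
      rw [Set.mem_ofPred_eq, ← ContinuousLinearMap.adjoint_inner_right,
        ← ContinuousLinearMap.star_eq_adjoint, hBs, hx, inner_zero_right]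
    · intro h
      refine ext_inner_left ℂ fun y => ?_
      rw [inner_zero_right, ← hBs, ContinuousLinearMap.star_eq_adjoint,
        ContinuousLinearMap.adjoint_inner_right]
      exact h _ (hBK y)
  have hvP : ∀ x, v (K.starProjection x) = v x := by
    intro x
    change W (K.orthogonalProjectionOnto _) = W (K.orthogonalProjectionOnto _)
    congr 1
    exact Submodule.orthogonalProjectionOnto_mem_subspace_eq_self _
  have hPA : K.starProjection ∈ A := starProjection_mem fun S hS x hx => by
    refine hKind {k | S k ∈ K} (IsClosed.preimage S.continuous
      B.range.isClosed_topologicalClosure) (fun y => ?_) x hx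
    rw [Set.mem_ofPred_eq, commute_apply hS hBA]
    exact hBK _
  refine ⟨v, mem_of_forall_commute fun S hS x => ?_, ?_, ?_, hker, ?_⟩
  · rw [← hvP x, ← hvP (S x), ← commute_apply hS hPA]
    refine hKind {k | S (v k) = v (S k)} (isClosed_eq (by fun_prop) (by fun_prop))
      (fun y => ?_) _ (Submodule.starProjection_apply_mem _ _)
    rw [Set.mem_ofPred_eq, hvB, commute_apply hS hBA, hvB, commute_apply hS hX]
  · ext y
    exact (hvB y).symm
  · rw [hvv]
    exact isStarProjection_starProjection
  · intro x
    constructor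
    · intro hx
      refine ext_inner_right ℂ fun y => ?_
      rw [inner_zero_left, ContinuousLinearMap.star_eq_adjoint,
        ContinuousLinearMap.adjoint_inner_left, ← hvP]
      refine hKind {k | ⟪x, v k⟫_ℂ = 0} (isClosed_eq (by fun_prop) (by fun_prop))
        (fun y => ?_) _ (Submodule.starProjection_apply_mem _ _)
      rw [Set.mem_ofPred_eq, hvB, ← ContinuousLinearMap.adjoint_inner_left,
        ← ContinuousLinearMap.star_eq_adjoint, hx, inner_zero_left]
    · intro hx
      have : star X = B * star v := by
        rw [← hBs, ← star_mul]
        congr 1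
        ext y
        exact (hvB y).symm
      rw [this, mul_apply_eq_comp, hx, map_zero]

end Polar

/-! ### Two-by-two operator matrices. -/

section Blocks

theorem sum_mul_sum_of_orthogonal {R ι : Type*} [Ring R] [Fintype ι] {c a b : ι → R}
    (hc : ∀ i j, i ≠ j → c i * c j = 0) (ha : ∀ i, a i * c i = a i) (hb : ∀ i, c i * b i = b i) :
    (∑ i, a i) * ∑ i, b i = ∑ i, a i * b i := by
  rw [Finset.sum_mul_sum]
  refine Finset.sum_congr rfl fun i _ => ?_
  refine Finset.sum_eq_single i (fun j _ hj => ?_) (by simp)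
  rw [← ha i, ← hb j, mul_assoc, ← mul_assoc (c i), hc i j hj.symm, zero_mul, mul_zero]

variable {R : Type*} [Ring R] [StarRing R]

/-- The operator matrix `[a, b; c, d]` with entries in the corner of `star v * v`, whose second
diagonal corner is identified with the first one by the partial isometry `v`. -/
def corner (v a b c d : R) : R := a + b * star v + v * c + v * d * star v

/-- The condition `p * v = 0` makes the final projection of `v` orthogonal to `p`, so `p`, `v`,
`star v`, `v * star v` are matrix units and `corner` multiplies as matrices over `pRp` do. -/
theorem corner_mul_corner {p v a b c d a' b' c' d' : R} (hv : star v * v = p) (hp : p * v = 0)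
    (ha : a * p = a) (hb : b * p = b) (hc : c * p = c) (hd : d * p = d)
    (ha' : p * a' = a') (hb' : p * b' = b') :
    corner v a b c d * corner v a' b' c' d' =
      corner v (a * a' + b * c') (a * b' + b * d') (c * a' + d * c') (c * b' + d * d') := by
  have hps : star v * p = 0 := by
    have h : star p = p := by rw [← hv, star_mul, star_star]
    rw [← h, ← star_mul, hp, star_zero]
  have h1 : ∀ a x : R, a * p = a → a * (v * x) = 0 := fun a x h => by
    rw [← h, mul_assoc, ← mul_assoc p, hp, zero_mul, mul_zero]
  have h2 : ∀ a : R, p * a = a → star v * a = 0 := fun a h => by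
    rw [← h, ← mul_assoc, hps, zero_mul]
  have h3 : ∀ a x : R, p * a = a → star v * (a * x) = 0 := fun a x h => by
    rw [← mul_assoc, h2 a h, zero_mul]
  have h4 : ∀ a x : R, a * p = a → a * (star v * (v * x)) = a * x := fun a x h => by
    rw [← mul_assoc (star v), hv, ← mul_assoc, h]
  simp only [corner, mul_add, add_mul, mul_assoc, h1 a _ ha, h1 c _ hc, h2 a' ha', h3 b' _ hb',
    h4 b _ hb, h4 d _ hd, mul_zero, add_zero]
  abel

end Blocks

/-! ### Projections with sum one; operators below a projection. -/

section Orthogonal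

variable {H : Type*} [NormedAddCommGroup H] [InnerProductSpace ℂ H] [CompleteSpace H]

theorem norm_sq_apply_of_isStarProjection {p : H →L[ℂ] H} (hp : IsStarProjection p) (x : H) :
    ((‖p x‖ : ℂ)) ^ 2 = ⟪p x, x⟫_ℂ := by
  have h : ⟪p x, p x⟫_ℂ = ⟪p x, x⟫_ℂ := by
    rw [← ContinuousLinearMap.adjoint_inner_left, ← ContinuousLinearMap.star_eq_adjoint,
      hp.isSelfAdjoint.star_eq, ← mul_apply_eq_comp, hp.isIdempotentElem.eq]
  rw [← h, inner_self_eq_norm_sq_to_K]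
  rfl

/-- Expanding `⟪y, y⟫` with `y = e j x` gives `∑ ‖e k y‖² = ‖y‖²`. The term `k = j` already exhausts
the right side, so the others vanish. -/
theorem mul_eq_zero_of_sum_eq_one {ι : Type*} [Fintype ι] {e : ι → H →L[ℂ] H}
    (he : ∀ i, IsStarProjection (e i)) (hsum : ∑ i, e i = 1) (i j : ι) (hij : i ≠ j) :
    e i * e j = 0 := by
  classical
  ext x
  have h : ∑ k, ‖e k (e j x)‖ ^ 2 = ‖e j x‖ ^ 2 := by
    have : ∑ k, ((‖e k (e j x)‖ : ℂ)) ^ 2 = (‖e j x‖ : ℂ) ^ 2 := by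
      simp_rw [norm_sq_apply_of_isStarProjection (he _)]
      rw [← sum_inner, ← sum_apply, hsum, one_apply_eq_self,
        inner_self_eq_norm_sq_to_K]
      rw [← norm_sq_apply_of_isStarProjection (he _)]
      rfl
    exact_mod_cast this
  have hj : e j (e j x) = e j x := by
    rw [← mul_apply_eq_comp, (he j).isIdempotentElem.eq]
  rw [← Finset.add_sum_erase _ _ (Finset.mem_univ j), hj, add_eq_left,
    Finset.sum_eq_zero_iff_of_nonneg (fun _ _ => sq_nonneg _)] at h
  have := h i (Finset.mem_erase.2 ⟨hij, Finset.mem_univ _⟩)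
  simpa using this

/-- Compression of `h ≤ p` by `1 - p` gives `(1-p)h(1-p) = 0`, that is, `√h (1-p) = 0`. -/
theorem mul_eq_self_of_le {p h : H →L[ℂ] H} (hp : IsStarProjection p) (h0 : 0 ≤ h) (hle : h ≤ p) :
    h * p = h ∧ p * h = h := by
  have hps := hp.one_sub.isSelfAdjoint.star_eq
  have hss : star (CFC.sqrt h) = CFC.sqrt h := (CFC.sqrt_nonneg h).isSelfAdjoint.star_eq
  have h1 : star (1 - p) * h * (1 - p) ≤ star (1 - p) * p * (1 - p) :=
    star_left_conjugate_le_conjugate hle _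
  rw [mul_assoc, mul_assoc, hp.mul_one_sub_self, mul_zero] at h1
  have h2 : star (1 - p) * (h * (1 - p)) = 0 := le_antisymm h1 (by
    rw [← mul_assoc]; exact star_left_conjugate_nonneg h0 _)
  have h3 : CFC.sqrt h * (1 - p) = 0 := by
    rw [← CStarRing.star_mul_self_eq_zero_iff, star_mul, hss, mul_assoc, ← mul_assoc (CFC.sqrt h),
      CFC.sqrt_mul_sqrt_self h h0, h2]
  have h4 : h * (1 - p) = 0 := by
    rw [← CFC.sqrt_mul_sqrt_self h h0, mul_assoc, h3, mul_zero]
  have h5 : h * p = h := by rw [mul_sub, mul_one, sub_eq_zero] at h4; exact h4.symm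
  refine ⟨h5, ?_⟩
  have := congrArg star h5
  rwa [star_mul, hp.isSelfAdjoint.star_eq, h0.isSelfAdjoint.star_eq] at this

end Orthogonal

/-! ### Invertible block operators and partial isometries. -/

section Corners

/-- Each block is, up to the scalar `t i`, its own inverse in the corner of `c i`; the blocks `t i •
a i` add up to the inverse. -/
theorem isUnit_sum_of_smul_mul_self {R ι : Type*} [Ring R] [Algebra ℂ R] [Fintype ι]
    {c a : ι → R} (hc : ∀ i j, i ≠ j → c i * c j = 0) (hsum : ∑ i, c i = 1)
    (ha : ∀ i, a i * c i = a i) (ha' : ∀ i, c i * a i = a i) (t : ι → ℂ)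
    (h : ∀ i, t i • (a i * a i) = c i) : IsUnit (∑ i, a i) := by
  refine isUnit_iff_exists.2 ⟨∑ i, t i • a i, ?_, ?_⟩
  · rw [sum_mul_sum_of_orthogonal hc ha (fun i => by rw [mul_smul_comm, ha']), ← hsum]
    exact Finset.sum_congr rfl fun i _ => by rw [mul_smul_comm, h]
  · rw [sum_mul_sum_of_orthogonal hc (fun i => by rw [smul_mul_assoc, ha]) ha', ← hsum]
    exact Finset.sum_congr rfl fun i _ => by rw [smul_mul_assoc, h]

variable {R : Type*} [Ring R] [StarRing R]

theorem corner_mul_one {p v a b c d : R} (hv : star v * v = p) (hpv : p * v = 0)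
    (hp : p * p = p) (ha : a * p = a) (hb : b * p = b) (hc : c * p = c) (hd : d * p = d) :
    corner v a b c d * corner v p 0 0 p = corner v a b c d := by
  rw [corner_mul_corner hv hpv ha hb hc hd hp (mul_zero _)]
  simp [ha, hb, hc, hd]

theorem one_mul_corner {p v a b c d : R} (hv : star v * v = p) (hpv : p * v = 0)
    (hp : p * p = p) (ha : p * a = a) (hb : p * b = b) (hc : p * c = c) (hd : p * d = d) :
    corner v p 0 0 p * corner v a b c d = corner v a b c d := by
  rw [corner_mul_corner hv hpv hp (zero_mul _) (zero_mul _) hp ha hb]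
  simp [ha, hb, hc, hd]

theorem smul_corner_mul_self [Algebra ℂ R] {p v a b c : R} (hv : star v * v = p)
    (hpv : p * v = 0) (ha : a * p = a) (ha' : p * a = a) (hb : b * p = b) (hb' : p * b = b)
    (hc : c * p = c) (hab : a * b = b * a) (hac : a * c = c * a)
    (h : a * a + b * c = (1 / 2 : ℂ) • p) (h' : a * a + c * b = (1 / 2 : ℂ) • p) :
    (2 : ℂ) • (corner v a b c (-a) * corner v a b c (-a)) = corner v p 0 0 p := by
  rw [corner_mul_corner hv hpv ha hb hc (by rw [neg_mul, ha]) ha' hb', h, mul_neg, hab,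
    add_neg_cancel, neg_mul, hac, add_neg_cancel, neg_mul_neg, add_comm (c * b), h']
  simp only [corner, zero_mul, mul_zero, add_zero, smul_add, smul_smul, mul_smul_comm,
    smul_mul_assoc]
  norm_num

/-- With `p = star v * v`, the product `(vp - v)*(vp - v)` is `p³ - p² - (p² - p) = 0`; the
C*-identity concludes. -/
theorem mul_eq_self_of_isIdempotentElem_star_mul {A : Type*} [NonUnitalNormedRing A] [StarRing A]
    [CStarRing A] {v : A} (h : IsIdempotentElem (star v * v)) : v * (star v * v) = v := by
  rw [← sub_eq_zero, ← CStarRing.star_mul_self_eq_zero_iff]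
  have h' : star v * v * (star v * v) = star v * v := h
  have : star (v * (star v * v) - v) * (v * (star v * v) - v) =
      star v * v * (star v * v) * (star v * v) - star v * v * (star v * v) -
        (star v * v * (star v * v) - star v * v) := by
    simp only [star_sub, star_mul, star_star, sub_mul, mul_sub, mul_assoc]
  rw [this, h', h', sub_self]

theorem isStarProjection_mul_star {A : Type*} [NonUnitalNormedRing A] [StarRing A]
    [CStarRing A] {v : A} (h : IsStarProjection (star v * v)) : IsStarProjection (v * star v) where
  isSelfAdjoint := .mul_star_self v
  isIdempotentElem := by
    have := mul_eq_self_of_isIdempotentElem_star_mul h.isIdempotentElem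
    rw [IsIdempotentElem, ← mul_assoc, mul_assoc v, this]

end Corners

/-! ### Invertibility of `E - P` and `F - P` in a normal form. -/

namespace TwoProjForm

variable {H : Type*} [NormedAddCommGroup H] [InnerProductSpace ℂ H] [CompleteSpace H]
  {A : VonNeumannAlgebra H} {E F : H →L[ℂ] H} (D : TwoProjForm A E F)

/-- The identities of the four summands of a normal form. -/
def unit : Fin 4 → H →L[ℂ] H :=
  ![D.p₁, corner D.v₂ D.p₂ 0 0 D.p₂, corner D.v₃ D.p₃ 0 0 D.p₃, D.p₄]

theorem v₂_mul : D.v₂ * D.p₂ = D.v₂ := by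
  have := mul_eq_self_of_isIdempotentElem_star_mul (v := D.v₂)
    (D.v₂_init ▸ D.p₂_proj.isIdempotentElem)
  rwa [D.v₂_init] at this

theorem v₃_mul : D.v₃ * D.p₃ = D.v₃ := by
  have := mul_eq_self_of_isIdempotentElem_star_mul (v := D.v₃)
    (D.v₃_init ▸ D.p₃_proj.isIdempotentElem)
  rwa [D.v₃_init] at this

theorem mul_star_v₂ : D.p₂ * star D.v₂ = star D.v₂ := by
  have := congrArg star D.v₂_mul
  rwa [star_mul, D.p₂_proj.isSelfAdjoint.star_eq] at this

theorem mul_star_v₃ : D.p₃ * star D.v₃ = star D.v₃ := by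
  have := congrArg star D.v₃_mul
  rwa [star_mul, D.p₃_proj.isSelfAdjoint.star_eq] at this

theorem q₂_proj : IsStarProjection (D.v₂ * star D.v₂) :=
  isStarProjection_mul_star (D.v₂_init ▸ D.p₂_proj)

theorem q₃_proj : IsStarProjection (D.v₃ * star D.v₃) :=
  isStarProjection_mul_star (D.v₃_init ▸ D.p₃_proj)

theorem orthogonal (i j : Fin 6) (hij : i ≠ j) :
    ![D.p₁, D.p₂, D.v₂ * star D.v₂, D.p₃, D.v₃ * star D.v₃, D.p₄] i *
      ![D.p₁, D.p₂, D.v₂ * star D.v₂, D.p₃, D.v₃ * star D.v₃, D.p₄] j = 0 := by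
  refine mul_eq_zero_of_sum_eq_one (fun i => ?_) ?_ i j hij
  · fin_cases i
    exacts [D.p₁_proj, D.p₂_proj, D.q₂_proj, D.p₃_proj, D.q₃_proj, D.p₄_proj]
  · rw [← D.sum_eq_one, Fin.sum_univ_six]
    simp only [Matrix.cons_val]
    abel

theorem p₂_mul_v₂ : D.p₂ * D.v₂ = 0 := by
  have h : D.p₂ * (D.v₂ * star D.v₂) = 0 := D.orthogonal 1 2 (by decide)
  rw [← D.v₂_mul, ← D.v₂_init, ← mul_assoc D.v₂, ← mul_assoc, D.v₂_init, h, zero_mul]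

theorem p₃_mul_v₃ : D.p₃ * D.v₃ = 0 := by
  have h : D.p₃ * (D.v₃ * star D.v₃) = 0 := D.orthogonal 3 4 (by decide)
  rw [← D.v₃_mul, ← D.v₃_init, ← mul_assoc D.v₃, ← mul_assoc, D.v₃_init, h, zero_mul]

theorem corner₂_one : corner D.v₂ D.p₂ 0 0 D.p₂ = D.p₂ + D.v₂ * star D.v₂ := by
  simp [corner, D.v₂_mul]

theorem corner₃_one : corner D.v₃ D.p₃ 0 0 D.p₃ = D.p₃ + D.v₃ * star D.v₃ := by
  simp [corner, D.v₃_mul]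

theorem sum_unit : ∑ i, D.unit i = 1 := by
  rw [← D.sum_eq_one, Fin.sum_univ_four]
  simp only [unit, Matrix.cons_val, corner₂_one, corner₃_one]

theorem unit_orthogonal (i j : Fin 4) (hij : i ≠ j) : D.unit i * D.unit j = 0 := by
  refine mul_eq_zero_of_sum_eq_one (fun i => ?_) D.sum_unit i j hij
  fin_cases i
  · exact D.p₁_proj
  · change IsStarProjection (corner D.v₂ D.p₂ 0 0 D.p₂)
    rw [corner₂_one]
    exact D.p₂_proj.add D.q₂_proj (D.orthogonal 1 2 (by decide))
  · change IsStarProjection (corner D.v₃ D.p₃ 0 0 D.p₃)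
    rw [corner₃_one]
    exact D.p₃_proj.add D.q₃_proj (D.orthogonal 3 4 (by decide))
  · exact D.p₄_proj

theorem E_eq_sum : E = ∑ i, ![D.p₁, corner D.v₂ D.p₂ 0 0 0, corner D.v₃ D.p₃ 0 0 0, 0] i := by
  rw [Fin.sum_univ_four]
  refine D.E_eq.trans ?_
  simp [corner]

theorem F_eq_sum : F = ∑ i, ![D.p₁, corner D.v₂ 0 0 0 D.p₂,
    corner D.v₃ D.h (CFC.sqrt (D.h * (D.p₃ - D.h))) (CFC.sqrt (D.h * (D.p₃ - D.h)))
      (D.p₃ - D.h), 0] i := by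
  rw [Fin.sum_univ_four]
  refine D.F_eq.trans ?_
  simp [corner, D.v₂_mul]

theorem P_eq_sum : D.P = ∑ i, ![0,
    corner D.v₂ ((1 / 2 : ℂ) • D.p₂) ((1 / 2 : ℂ) • D.p₂) ((1 / 2 : ℂ) • D.p₂)
      ((1 / 2 : ℂ) • D.p₂),
    corner D.v₃ ((1 / 2 : ℂ) • D.p₃) ((Complex.I / 2) • D.p₃) ((-Complex.I / 2) • D.p₃)
      ((1 / 2 : ℂ) • D.p₃), D.p₄] i := by
  rw [Fin.sum_univ_four, P]
  simp only [Matrix.cons_val, corner, smul_mul_assoc, mul_smul_comm, mul_star_v₂, mul_star_v₃,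
    v₂_mul, v₃_mul]
  module

theorem P_mem : D.P ∈ A := by
  have h : ∀ {v}, v ∈ A → v * star v ∈ A := fun h => mul_mem h (star_mem h)
  exact add_mem (add_mem (smul_mem' A _ (add_mem (add_mem (add_mem D.p₂_mem (star_mem D.v₂_mem))
    D.v₂_mem) (h D.v₂_mem))) (smul_mem' A _ (add_mem (sub_mem (add_mem D.p₃_mem
    (smul_mem' A _ (star_mem D.v₃_mem))) (smul_mem' A _ D.v₃_mem)) (h D.v₃_mem)))) D.p₄_mem

theorem isStarProjection_P : IsStarProjection D.P where
  isSelfAdjoint := by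
    have h2 := D.p₂_proj.isSelfAdjoint.star_eq
    have h3 := D.p₃_proj.isSelfAdjoint.star_eq
    have h4 := D.p₄_proj.isSelfAdjoint.star_eq
    rw [IsSelfAdjoint, P]
    simp only [star_add, star_sub, star_smul, star_mul, star_star, h2, h3, h4, RCLike.star_def,
      map_div₀, map_one, Complex.conj_I, Complex.conj_ofNat]
    module
  isIdempotentElem := by
    have h2 : D.p₂ * D.p₂ = D.p₂ := D.p₂_proj.isIdempotentElem
    have h3 : D.p₃ * D.p₃ = D.p₃ := D.p₃_proj.isIdempotentElem
    have h4 : D.p₄ * D.p₄ = D.p₄ := D.p₄_proj.isIdempotentElem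
    rw [IsIdempotentElem, P_eq_sum, sum_mul_sum_of_orthogonal D.unit_orthogonal]
    · refine Finset.sum_congr rfl fun i _ => ?_
      fin_cases i
      · exact mul_zero _
      · refine (corner_mul_corner D.v₂_init D.p₂_mul_v₂ ?_ ?_ ?_ ?_ ?_ ?_).trans ?_ <;>
          simp only [smul_mul_assoc, mul_smul_comm, h2]
        simp only [Fin.mk_one, Matrix.cons_val]
        congr 1 <;> module
      · refine (corner_mul_corner D.v₃_init D.p₃_mul_v₃ ?_ ?_ ?_ ?_ ?_ ?_).trans ?_ <;>
          simp only [smul_mul_assoc, mul_smul_comm, h3]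
        simp only [Fin.reduceFinMk, Matrix.cons_val]
        congr 1 <;> match_scalars <;> ring_nf <;> norm_num [Complex.I_sq]
      · exact h4
    · intro i
      fin_cases i
      · exact zero_mul _
      · apply corner_mul_one D.v₂_init D.p₂_mul_v₂ h2 <;> simp only [smul_mul_assoc, h2]
      · apply corner_mul_one D.v₃_init D.p₃_mul_v₃ h3 <;> simp only [smul_mul_assoc, h3]
      · exact h4
    · intro i
      fin_cases i
      · exact mul_zero _
      · apply one_mul_corner D.v₂_init D.p₂_mul_v₂ h2 <;> simp only [mul_smul_comm, h2]
      · apply one_mul_corner D.v₃_init D.p₃_mul_v₃ h3 <;> simp only [mul_smul_comm, h3]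
      · exact h4

/-- An operator that is diagonal with respect to the four summands, of the form `[a, b; c, -a]` on
the second and third ones, with square `1/2` there, is invertible. -/
theorem isUnit_of_corners {X a b c a' b' c' : H →L[ℂ] H}
    (hX : X = ∑ i, ![D.p₁, corner D.v₂ a b c (-a), corner D.v₃ a' b' c' (-a'), -D.p₄] i)
    (h₂ : ∀ x ∈ [a, b, c], x * D.p₂ = x ∧ D.p₂ * x = x)
    (h₃ : ∀ x ∈ [a', b', c'], x * D.p₃ = x ∧ D.p₃ * x = x)
    (hab : a * b = b * a) (hac : a * c = c * a) (hab' : a' * b' = b' * a')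
    (hac' : a' * c' = c' * a') (hs : a * a + b * c = (1 / 2 : ℂ) • D.p₂)
    (hbc : b * c = c * b) (hs' : a' * a' + b' * c' = (1 / 2 : ℂ) • D.p₃)
    (hbc' : b' * c' = c' * b') : IsUnit X := by
  have p2 : D.p₂ * D.p₂ = D.p₂ := D.p₂_proj.isIdempotentElem
  have p3 : D.p₃ * D.p₃ = D.p₃ := D.p₃_proj.isIdempotentElem
  have p1 : D.p₁ * D.p₁ = D.p₁ := D.p₁_proj.isIdempotentElem
  have p4 : D.p₄ * D.p₄ = D.p₄ := D.p₄_proj.isIdempotentElem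
  simp only [List.mem_cons, List.not_mem_nil, or_false, forall_eq_or_imp, forall_eq] at h₂ h₃
  obtain ⟨⟨ha1, ha2⟩, ⟨hb1, hb2⟩, hc1, hc2⟩ := h₂
  obtain ⟨⟨ha1', ha2'⟩, ⟨hb1', hb2'⟩, hc1', hc2'⟩ := h₃
  rw [hX]
  refine isUnit_sum_of_smul_mul_self D.unit_orthogonal D.sum_unit (fun i => ?_) (fun i => ?_)
    -- The blocks `p₁` and `-p₄` square to the units of their summands, the middle ones to half of
    -- theirs.
    ![1, 2, 2, 1] (fun i => ?_)
  · fin_cases i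
    · exact p1
    · exact corner_mul_one D.v₂_init D.p₂_mul_v₂ p2 ha1 hb1 hc1 (by rw [neg_mul, ha1])
    · exact corner_mul_one D.v₃_init D.p₃_mul_v₃ p3 ha1' hb1' hc1' (by rw [neg_mul, ha1'])
    · exact (neg_mul _ _).trans (congrArg _ p4)
  · fin_cases i
    · exact p1
    · exact one_mul_corner D.v₂_init D.p₂_mul_v₂ p2 ha2 hb2 hc2 (by rw [mul_neg, ha2])
    · exact one_mul_corner D.v₃_init D.p₃_mul_v₃ p3 ha2' hb2' hc2' (by rw [mul_neg, ha2'])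
    · exact (mul_neg _ _).trans (congrArg _ p4)
  · fin_cases i
    · exact (one_smul _ _).trans p1
    · exact smul_corner_mul_self D.v₂_init D.p₂_mul_v₂ ha1 ha2 hb1 hb2 hc1 hab hac hs
        (hbc ▸ hs)
    · exact smul_corner_mul_self D.v₃_init D.p₃_mul_v₃ ha1' ha2' hb1' hb2' hc1' hab' hac' hs'
        (hbc' ▸ hs')
    · exact (one_smul _ _).trans ((neg_mul_neg _ _).trans p4)

theorem isUnit_E_sub_P : IsUnit (E - D.P) := by
  have p2 : D.p₂ * D.p₂ = D.p₂ := D.p₂_proj.isIdempotentElem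
  have p3 : D.p₃ * D.p₃ = D.p₃ := D.p₃_proj.isIdempotentElem
  refine D.isUnit_of_corners (a := (1 / 2 : ℂ) • D.p₂) (b := (-1 / 2 : ℂ) • D.p₂)
    (c := (-1 / 2 : ℂ) • D.p₂) (a' := (1 / 2 : ℂ) • D.p₃) (b' := (-Complex.I / 2) • D.p₃)
    (c' := (Complex.I / 2) • D.p₃) ?_ ?_ ?_ ?_ ?_ ?_ ?_ ?_ ?_ ?_ ?_
  · refine (congrArg₂ (fun x y => x - y) D.E_eq_sum D.P_eq_sum).trans ?_
    refine (Finset.sum_sub_distrib _ _).symm.trans ?_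
    refine Finset.sum_congr rfl fun i _ => ?_
    fin_cases i <;>
      simp only [Fin.mk_one, Fin.zero_eta, Fin.reduceFinMk, Matrix.cons_val, corner,
        smul_mul_assoc, mul_smul_comm, neg_mul, mul_neg, mul_zero, zero_mul] <;> module
  all_goals simp only [List.mem_cons, List.not_mem_nil, or_false, forall_eq_or_imp, forall_eq,
    smul_mul_assoc, mul_smul_comm, p2, p3, and_self]
  all_goals match_scalars <;> ring_nf <;> norm_num [Complex.I_sq]

theorem isUnit_F_sub_P : IsUnit (F - D.P) := by
  have p2 : D.p₂ * D.p₂ = D.p₂ := D.p₂_proj.isIdempotentElem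
  have p3 : D.p₃ * D.p₃ = D.p₃ := D.p₃_proj.isIdempotentElem
  obtain ⟨hp, ph⟩ := mul_eq_self_of_le D.p₃_proj D.h_nonneg D.h_le
  have hcomm : Commute D.h (D.p₃ - D.h) := by
    rw [commute_iff_eq, mul_sub, sub_mul, hp, ph]
  have hnn : 0 ≤ D.h * (D.p₃ - D.h) := hcomm.mul_nonneg D.h_nonneg (sub_nonneg.2 D.h_le)
  set s := CFC.sqrt (D.h * (D.p₃ - D.h)) with hs
  have hss : s * s = D.h - D.h * D.h := by
    rw [hs, CFC.sqrt_mul_sqrt_self _ hnn, mul_sub, hp]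
  have hsh : s * D.h = D.h * s := by
    have : Commute (D.h * (D.p₃ - D.h)) D.h := (Commute.refl _).mul_left hcomm.symm
    exact this.cfcₙ_nnreal _
  obtain ⟨sp, ps⟩ : s * D.p₃ = s ∧ D.p₃ * s = s := by
    have hle : D.h * (D.p₃ - D.h) ≤ D.p₃ := by
      refine le_trans ?_ D.h_le
      rw [mul_sub, hp, sub_le_self_iff]
      exact (Commute.refl _).mul_nonneg D.h_nonneg D.h_nonneg
    have h2 := (mul_eq_self_of_le D.p₃_proj hnn hle).1
    have hstar : star s = s := (CFC.sqrt_nonneg _).isSelfAdjoint.star_eq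
    have h3 : s * (1 - D.p₃) = 0 := by
      rw [← CStarRing.star_mul_self_eq_zero_iff, star_mul, hstar, mul_assoc, ← mul_assoc s,
        CFC.sqrt_mul_sqrt_self _ hnn, mul_sub _ 1, mul_one, h2, sub_self, mul_zero]
    have h4 : s * D.p₃ = s := by rw [mul_sub, mul_one, sub_eq_zero] at h3; exact h3.symm
    refine ⟨h4, ?_⟩
    have := congrArg star h4
    rwa [star_mul, hstar, D.p₃_proj.isSelfAdjoint.star_eq] at this
  -- The third block is `[h - 1/2, s - i/2; s + i/2, 1/2 - h]`, with square `(h - 1/2)² + s² + 1/4 =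
  -- 1/2` because `s² = h - h²`.
  refine D.isUnit_of_corners (a := (-1 / 2 : ℂ) • D.p₂) (b := (-1 / 2 : ℂ) • D.p₂)
    (c := (-1 / 2 : ℂ) • D.p₂) (a' := D.h - (1 / 2 : ℂ) • D.p₃)
    (b' := s - (Complex.I / 2) • D.p₃)
    (c' := s + (Complex.I / 2) • D.p₃) ?_ ?_ ?_ ?_ ?_ ?_ ?_ ?_ ?_ ?_ ?_
  · have hF := D.F_eq_sum
    rw [← hs] at hF
    refine (congrArg₂ (fun x y => x - y) hF D.P_eq_sum).trans ?_
    refine (Finset.sum_sub_distrib _ _).symm.trans ?_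
    refine Finset.sum_congr rfl fun i _ => ?_
    fin_cases i <;>
      simp only [Fin.mk_one, Fin.zero_eta, Fin.reduceFinMk, Matrix.cons_val, corner,
        smul_mul_assoc, mul_smul_comm, neg_mul, mul_neg, mul_zero, zero_mul, mul_add,
        sub_mul, mul_sub] <;> module
  all_goals simp only [List.mem_cons, List.not_mem_nil, or_false, forall_eq_or_imp, forall_eq,
    smul_mul_assoc, mul_smul_comm, p2, p3, and_self, add_mul, mul_add, sub_mul, mul_sub, hp, ph,
    sp, ps, hsh, hss]
  all_goals match_scalars <;> ring_nf <;> norm_num [Complex.I_sq]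

end TwoProjForm

/-! ### From `E - P` and `F - P` to `T - P`. -/

section Inverse

variable {H : Type*} [NormedAddCommGroup H] [InnerProductSpace ℂ H] [CompleteSpace H]

theorem kerProj_mem {A : VonNeumannAlgebra H} {T : H →L[ℂ] H} (hT : T ∈ A) : kerProj T ∈ A :=
  starProjection_mem fun S hS x hx => by
    rw [LinearMap.mem_ker] at hx ⊢
    change T (S x) = 0
    rw [← commute_apply hS hT]
    exact (congrArg S hx).trans (map_zero S)

theorem rangeProj_mem {A : VonNeumannAlgebra H} {T : H →L[ℂ] H} (hT : T ∈ A) :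
    rangeProj T ∈ A :=
  starProjection_mem fun S hS x hx => by
    have h : Set.range T ⊆ S ⁻¹' closure (Set.range T) := by
      rintro _ ⟨y, rfl⟩
      rw [Set.mem_preimage, commute_apply hS hT]
      exact subset_closure ⟨_, rfl⟩
    exact closure_minimal h (isClosed_closure.preimage S.continuous) hx

theorem apply_kerProj (T : H →L[ℂ] H) (x : H) : T (kerProj T x) = 0 :=
  LinearMap.mem_ker.1 (Submodule.starProjection_apply_mem T.ker x)

theorem kerProj_eq_self {T : H →L[ℂ] H} {x : H} (hx : T x = 0) : kerProj T x = x :=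
  Submodule.starProjection_eq_self_iff.2 (LinearMap.mem_ker.2 hx)

theorem rangeProj_apply (T : H →L[ℂ] H) (x : H) : rangeProj T (T x) = T x :=
  Submodule.starProjection_eq_self_iff.2 (T.range.le_topologicalClosure ⟨x, rfl⟩)

theorem exists_apply_eq_rangeProj {T : H →L[ℂ] H} (hT : IsClosed (Set.range T)) (x : H) :
    ∃ y, T y = rangeProj T x := by
  have h : rangeProj T x ∈ T.range.topologicalClosure := Submodule.starProjection_apply_mem _ x
  have h' : rangeProj T x ∈ closure (Set.range T) := h
  rwa [hT.closure_eq] at h'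

/-- If `Tx = Px`, then `(F - P)Px = 0`, so `Px = 0 = Tx` and `(E - P)x = 0`, whence `x = 0`. For
surjectivity onto `(F - P)w`, a preimage `a` of `Fw` under `T` is corrected by a kernel vector so
that its image under `P` becomes `Pw`. -/
theorem isUnit_sub_of_isUnit {T P : H →L[ℂ] H} (hT : IsClosed (Set.range T))
    (hP : IsIdempotentElem P) (hE : IsUnit (1 - kerProj T - P)) (hF : IsUnit (rangeProj T - P)) :
    IsUnit (T - P) := by
  have hPP : ∀ x, P (P x) = P x := fun x => by rw [← mul_apply_eq_comp, hP.eq]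
  rw [ContinuousLinearMap.isUnit_iff_bijective] at hE hF ⊢
  constructor
  · rw [injective_iff_map_eq_zero]
    intro x hx
    have h1 : T x = P x := sub_eq_zero.1 hx
    have h2 : P x = 0 := by
      refine (injective_iff_map_eq_zero _).1 hF.1 _ ?_
      change rangeProj T (P x) - P (P x) = 0
      rw [hPP, ← h1, rangeProj_apply, sub_self]
    refine (injective_iff_map_eq_zero _).1 hE.1 _ ?_
    change x - kerProj T x - P x = 0
    rw [kerProj_eq_self (h1.trans h2), h2, sub_self, sub_zero]
  · intro z
    obtain ⟨w, rfl⟩ := hF.2 z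
    obtain ⟨a, ha⟩ := exists_apply_eq_rangeProj hT w
    obtain ⟨u, hu⟩ := hE.2 (a - w)
    have hu' : u - kerProj T u - P u = a - w := hu
    -- The equation for `u` says `a + kerProj T u = w + (u - P u)`, and `P` annihilates `u - P u`.
    refine ⟨a + kerProj T u, ?_⟩
    change T (a + kerProj T u) - P (a + kerProj T u) = rangeProj T w - P w
    have h1 : a + kerProj T u = w + (u - P u) + (2 : ℂ) • kerProj T u - (2 : ℂ) • kerProj T u +
      ((a - w) - (u - kerProj T u - P u)) := by module
    rw [map_add T, apply_kerProj, add_zero, ha, h1, hu', map_add P, map_sub P, map_add P,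
      map_add P, map_sub P, hPP]
    simp

theorem isUnit_of_isUnit_coe {A : VonNeumannAlgebra H} {T : A} (hT : IsUnit (T : H →L[ℂ] H)) :
    IsUnit T := by
  obtain ⟨S, h1, h2⟩ := isUnit_iff_exists.1 hT
  have hS : S ∈ A := by
    rw [← commutant_commutant A, mem_commutant_iff]
    intro R hR
    have h := mem_commutant_iff.1 hR T T.2
    calc R * S = S * (T * R) * S := by rw [← mul_assoc S, h2, one_mul]
      _ = S * R := by rw [h, mul_assoc, mul_assoc, h1, mul_one]
  exact isUnit_iff_exists.2 ⟨⟨S, hS⟩, Subtype.ext h1, Subtype.ext h2⟩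

theorem exists_isStarProjection_isUnit_sub {A : VonNeumannAlgebra H} (T : A)
    (hT : IsClosed (Set.range (T : H →L[ℂ] H)))
    (D : A.TwoProjForm (1 - kerProj (T : H →L[ℂ] H)) (rangeProj (T : H →L[ℂ] H))) :
    ∃ Q : A, (Q : H →L[ℂ] H) = D.P ∧ IsStarProjection Q ∧ IsUnit (T - Q) :=
  ⟨⟨D.P, D.P_mem⟩, rfl, ⟨Subtype.ext D.isStarProjection_P.isIdempotentElem,
    Subtype.ext D.isStarProjection_P.isSelfAdjoint⟩,
    isUnit_of_isUnit_coe (isUnit_sub_of_isUnit hT D.isStarProjection_P.isIdempotentElem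
      D.isUnit_E_sub_P D.isUnit_F_sub_P)⟩

end Inverse

/-! ### The generic part of two projections. -/

section Halmos

variable {H : Type*} [NormedAddCommGroup H] [InnerProductSpace ℂ H] [CompleteSpace H]

theorem IsStarProjection.eq_of_apply_eq_zero_iff {p q : H →L[ℂ] H} (hp : IsStarProjection p)
    (hq : IsStarProjection q) (h : ∀ x, p x = 0 ↔ q x = 0) : p = q := by
  have h1 : ∀ {p q : H →L[ℂ] H}, IsStarProjection p → (∀ x, p x = 0 → q x = 0) → q * p = q := by
    intro p q hp h
    ext x
    have h2 := h (x - p x) (by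
      rw [map_sub, ← mul_apply_eq_comp, hp.isIdempotentElem.eq, sub_self])
    rw [map_sub, sub_eq_zero] at h2
    exact h2.symm
  have h2 := h1 hp fun x => (h x).1
  have h3 := congrArg star (h1 hq fun x => (h x).2)
  rw [star_mul, hp.isSelfAdjoint.star_eq, hq.isSelfAdjoint.star_eq] at h3
  exact h3.symm.trans h2

theorem mul_eq_zero_of_ker {X v : H →L[ℂ] H} (h : ∀ x, X x = 0 → v x = 0) {Y : H →L[ℂ] H}
    (hXY : X * Y = 0) : v * Y = 0 := by
  ext x
  exact h _ (congrArg (fun f : H →L[ℂ] H => f x) hXY)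

theorem apply_eq_zero_of_inner {p : H →L[ℂ] H} (hp : IsStarProjection p) {x : H}
    (h : ⟪p x, x⟫_ℂ = 0) : p x = 0 := by
  rw [← norm_sq_apply_of_isStarProjection hp] at h
  simpa using h

/-- The off-diagonal entry `X = (1 - E)FE` measures the failure of `E` and `F` to commute. Its
initial and final projections `p₃` and `v * star v` carry the generic part. What is left of `E` and
`1 - E` commutes with `F` and splits into the four intersections. The operator `w` is the polar part
of `FE`; it supplies the equivalence needed later to compare `p₂` with `q₂`. -/
theorem exists_twoProj_decomposition {A : VonNeumannAlgebra H} {E F : H →L[ℂ] H} (hEA : E ∈ A)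
    (hFA : F ∈ A) (hE : IsStarProjection E) (hF : IsStarProjection F) :
    ∃ p₁ ∈ A, ∃ p₂ ∈ A, ∃ p₃ ∈ A, ∃ p₄ ∈ A, ∃ q₂ ∈ A, ∃ v ∈ A, ∃ h ∈ A, ∃ w ∈ A,
      IsStarProjection p₁ ∧ IsStarProjection p₂ ∧ IsStarProjection p₃ ∧ IsStarProjection p₄ ∧
      IsStarProjection q₂ ∧ star v * v = p₃ ∧
      p₁ + (p₂ + q₂) + (p₃ + v * star v) + p₄ = 1 ∧ 0 ≤ h ∧ h ≤ p₃ ∧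
      (∀ x : H, p₃ x = x → h x = 0 → x = 0) ∧
      (∀ x : H, p₃ x = x → (p₃ - h) x = 0 → x = 0) ∧
      E = p₁ + p₂ + p₃ ∧
      F = p₁ + q₂ + (h + CFC.sqrt (h * (p₃ - h)) * star v + v * CFC.sqrt (h * (p₃ - h)) +
        v * (p₃ - h) * star v) ∧
      E * p₂ = p₂ ∧ F * q₂ = q₂ ∧ star w * w = E - p₂ ∧ w * star w = F - q₂ := by
  have EE : E * E = E := hE.isIdempotentElem
  have FF : F * F = F := hF.isIdempotentElem
  have Es : star E = E := hE.isSelfAdjoint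
  have Fs : star F = F := hF.isSelfAdjoint
  obtain ⟨X, hX⟩ : ∃ X, X = (1 - E) * F * E := ⟨_, rfl⟩
  have hXs : star X = E * F * (1 - E) := by
    rw [hX, star_mul, star_mul, star_sub, star_one, Es, Fs, mul_assoc]
  have hXA : X ∈ A := hX ▸ mul_mem (mul_mem (sub_mem (one_mem A) hEA) hFA) hEA
  obtain ⟨v, hvA, hXv, hvp, hker, hker'⟩ := exists_polar hXA
  obtain ⟨s, hs⟩ : ∃ s, s = CFC.abs X := ⟨_, rfl⟩
  rw [← hs] at hXv
  have hs0 : 0 ≤ s := hs ▸ CFC.abs_nonneg X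
  have hss : s * s = star X * X := hs ▸ CFC.abs_mul_abs X
  have hsS : star s = s := hs0.isSelfAdjoint.star_eq
  obtain ⟨p₃, hp₃⟩ : ∃ p, p = star v * v := ⟨_, rfl⟩
  rw [← hp₃] at hvp
  have hvp3 : v * p₃ = v := by
    rw [hp₃]
    exact mul_eq_self_of_isIdempotentElem_star_mul (hp₃ ▸ hvp.isIdempotentElem)
  have p33 : p₃ * p₃ = p₃ := hvp.isIdempotentElem
  have p3s : star p₃ = p₃ := hvp.isSelfAdjoint
  have hp3v : p₃ * star v = star v := by
    have := congrArg star hvp3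
    rwa [star_mul, p3s] at this
  -- Equal kernels let annihilation relations pass between `X` and `v`, and between their adjoints.
  have toV : ∀ Y, X * Y = 0 → v * Y = 0 := fun Y =>
    mul_eq_zero_of_ker fun x => (hker x).1
  have toX : ∀ Y, v * Y = 0 → X * Y = 0 := fun Y =>
    mul_eq_zero_of_ker fun x => (hker x).2
  have toVs : ∀ Y, star X * Y = 0 → star v * Y = 0 := fun Y =>
    mul_eq_zero_of_ker fun x => (hker' x).1
  have toXs : ∀ Y, star v * Y = 0 → star X * Y = 0 := fun Y =>
    mul_eq_zero_of_ker fun x => (hker' x).2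
  have vE : v * E = v := by
    have := toV (1 - E) (by
      rw [hX, mul_assoc, mul_sub, mul_one, EE, sub_self, mul_zero])
    linear_combination (norm := noncomm_ring) -this
  have vsE : star v * E = 0 := toVs E (by
    rw [hXs, mul_assoc, sub_mul, one_mul, EE, sub_self, mul_zero])
  have Evs : E * star v = star v := by
    have := congrArg star vE
    rwa [star_mul, Es] at this
  have Ev : E * v = 0 := by
    have := congrArg star vsE
    rwa [star_mul, Es, star_star, star_zero] at this
  have Ep3 : E * p₃ = p₃ := by rw [hp₃, ← mul_assoc, Evs]
  have p3E : p₃ * E = p₃ := by rw [hp₃, mul_assoc, vE]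
  have Xp3 : X * p₃ = X := by
    have := toX (1 - p₃) (by rw [mul_sub, mul_one, hvp3, sub_self])
    linear_combination (norm := noncomm_ring) -this
  -- the part of `E` that commutes with `F`
  obtain ⟨e, he⟩ : ∃ e, e = E - p₃ := ⟨_, rfl⟩
  have hep : IsStarProjection e := he ▸ hvp.sub_of_mul_eq_right hE Ep3
  have es : star e = e := hep.isSelfAdjoint
  have ee : e * e = e := hep.isIdempotentElem
  have Ee : E * e = e := by rw [he, mul_sub, EE, Ep3]
  have eE : e * E = e := by rw [he, sub_mul, EE, p3E]
  have Xe : X * e = 0 := by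
    rw [he, mul_sub, Xp3, hX, mul_assoc, EE, sub_self]
  have EFe : E * (F * e) = F * e := by
    rw [hX, mul_assoc, Ee] at Xe
    linear_combination (norm := noncomm_ring) -Xe
  have p3Fe : p₃ * (F * e) = 0 := by
    rw [hp₃, mul_assoc, toV (F * e), mul_zero]
    rw [hX, mul_assoc, EFe]
    linear_combination (norm := noncomm_ring) (1 - E) * FF * e - EFe
  have eFe : e * (F * e) = F * e := by
    rw [he] at EFe p3Fe ⊢
    linear_combination (norm := noncomm_ring) EFe - p3Fe
  -- `F * e` equals the self-adjoint `e * F * e`, so it equals its adjoint `e * F`.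
  have eF : e * F = F * e := by
    have := congrArg star eFe
    simp only [star_mul, es, Fs] at this
    rw [← this, mul_assoc, eFe]
  -- the part of `1 - E` that commutes with `F`
  obtain ⟨q₃, hq₃⟩ : ∃ q, q = v * star v := ⟨_, rfl⟩
  have hqp : IsStarProjection q₃ := hq₃ ▸ isStarProjection_mul_star (hp₃ ▸ hvp)
  have Eq3 : E * q₃ = 0 := by rw [hq₃, ← mul_assoc, Ev, zero_mul]
  obtain ⟨f, hf⟩ : ∃ f, f = 1 - E - q₃ := ⟨_, rfl⟩
  have hfp : IsStarProjection f := hf ▸ hqp.sub_of_mul_eq_right hE.one_sub (by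
    rw [sub_mul, one_mul, Eq3, sub_zero])
  have fs : star f = f := hfp.isSelfAdjoint
  have ff : f * f = f := hfp.isIdempotentElem
  have Ef : E * f = 0 := by rw [hf, mul_sub, mul_sub, mul_one, EE, Eq3]; simp
  have vsq : star v * q₃ = star v := by rw [hq₃, ← mul_assoc, ← hp₃, hp3v]
  have EFf : E * (F * f) = 0 := by
    have h1 : star X * f = 0 := toXs _ (by
      rw [hf, mul_sub, mul_sub, mul_one, vsE, vsq]; simp)
    rw [hXs] at h1
    linear_combination (norm := noncomm_ring) h1 + E * F * Ef
  have q3Ff : q₃ * (F * f) = 0 := by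
    rw [hq₃, mul_assoc, toVs (F * f), mul_zero]
    rw [hXs]
    linear_combination (norm := noncomm_ring) E * FF * f + EFf - E * F * EFf
  have fFf : f * (F * f) = F * f := by
    have : F * f = (E + q₃ + f) * (F * f) := by rw [hf]; noncomm_ring
    linear_combination (norm := noncomm_ring) -this - EFf - q3Ff
  have fF : f * F = F * f := by
    have := congrArg star fFf
    simp only [star_mul, fs, Fs] at this
    rw [← this, mul_assoc, fFf]
  -- the generic part
  obtain ⟨h, hh⟩ : ∃ h, h = p₃ * F * p₃ := ⟨_, rfl⟩
  have hp3 : h * p₃ = h := by rw [hh, mul_assoc, p33]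
  have p3h : p₃ * h = h := by rw [hh, ← mul_assoc, ← mul_assoc, p33]
  have hnn : 0 ≤ h := by
    have := star_left_conjugate_nonneg hF.nonneg p₃
    rwa [p3s, ← hh] at this
  have hle : h ≤ p₃ := by
    have := star_left_conjugate_nonneg hF.one_sub.nonneg p₃
    rw [p3s, mul_sub, sub_mul, mul_one, p33, ← hh] at this
    exact sub_nonneg.1 this
  -- Split `1 = p₃ + e + (1 - E)` on the left: the `e` term vanishes because `e` commutes with `F`
  -- and is orthogonal to `p₃`.
  have Fp3 : F * p₃ = h + X := by
    have h1 : e * (F * p₃) = 0 := by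
      have := congrArg star p3Fe
      rwa [star_mul, star_mul, p3s, es, Fs, star_zero, mul_assoc] at this
    have h2 : X = (1 - E) * F * p₃ := by
      rw [← Xp3, hX, mul_assoc, Ep3]
    rw [h2, hh]
    rw [he] at h1
    linear_combination (norm := noncomm_ring) h1
  have p3F : p₃ * F = h + star X := by
    have := congrArg star Fp3
    rwa [star_mul, star_add, p3s, Fs, hnn.isSelfAdjoint.star_eq] at this
  -- `X*X = (p₃F - h)(Fp₃ - h) = h - h²`, so `|X|` is the square root in the normal form.
  have hss' : s * s = h * (p₃ - h) := by
    have h1 : star X = p₃ * F - h := by rw [p3F]; abel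
    have h2 : X = F * p₃ - h := by rw [Fp3]; abel
    rw [hss, h1, h2]
    linear_combination (norm := (rw [hh]; noncomm_ring)) p₃ * FF * p₃ +
      p₃ * F * p33 * F * p₃ + p₃ * F * p33 * F * p₃ - p₃ * F * p33
  have hsq : CFC.sqrt (h * (p₃ - h)) = s := CFC.sqrt_unique hss' hs0
  have hsh : s * h = h * s := by
    have hc : Commute (h * (p₃ - h)) h := by
      rw [commute_iff_eq]
      linear_combination (norm := noncomm_ring) h * p3h - h * hp3
    have := hc.cfcₙ_nnreal NNReal.sqrt
    rw [← hsq]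
    exact this
  have sp3 : s * p₃ = s := by
    have : s * (1 - p₃) = 0 := by
      rw [← CStarRing.star_mul_self_eq_zero_iff, star_mul, hsS, mul_assoc, ← mul_assoc s, hss,
        mul_assoc, mul_sub, Xp3, mul_one, sub_self, mul_zero, mul_zero]
    linear_combination (norm := noncomm_ring) -this
  -- The difference `Y` of the two sides satisfies `Y s = 0`. Since `X = v s`, this gives `X * star
  -- Y = 0`, then `v * star Y = 0`; as `Y = Y p₃` and `p₃ = star v * v`, it follows that `Y = 0`.
  have Fv : F * v = s + v * (p₃ - h) := by
    obtain ⟨Y, hY⟩ : ∃ Y, Y = F * v - s - v * (p₃ - h) := ⟨_, rfl⟩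
    have h1 : Y * s = 0 := by
      rw [hY]
      linear_combination (norm := noncomm_ring) -(F * hXv) - F * Fp3 + FF * p₃ + Fp3 + F * p3h -
        Fp3 * h - hss' - hp3 - hvp3 * s + hXv - v * hsh - hXv * h
    have h2 : Y * p₃ = Y := by
      rw [hY]
      linear_combination (norm := noncomm_ring) F * hvp3 - sp3 - v * p33 + v * hp3
    have h3 : s * star Y = 0 := by
      have := congrArg star h1
      rwa [star_mul, hsS, star_zero] at this
    have h4 : v * star Y = 0 := toV _ (by rw [hXv, mul_assoc, h3, mul_zero])
    have h5 : star Y = 0 := by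
      have := congrArg star h2
      rwa [star_mul, p3s, hp₃, mul_assoc, h4, mul_zero, eq_comm] at this
    have h6 : Y = 0 := star_eq_zero.1 h5
    linear_combination (norm := noncomm_ring) h6 - hY
  have hFe : IsStarProjection (F * e) := hF.mul hep eF.symm
  have hFf : IsStarProjection (F * f) := hF.mul hfp fF.symm
  have hp₂ : IsStarProjection (e - F * e) := hFe.sub_of_mul_eq_right hep eFe
  have hp₄ : IsStarProjection (f - F * f) := hFf.sub_of_mul_eq_right hfp fFf
  have hp₃A : p₃ ∈ A := hp₃ ▸ mul_mem (star_mem hvA) hvA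
  have heA : e ∈ A := he ▸ sub_mem hEA hp₃A
  have hfA : f ∈ A := hf ▸ sub_mem (sub_mem (one_mem A) hEA) (hq₃ ▸ mul_mem hvA (star_mem hvA))
  have hFeA : F * e ∈ A := mul_mem hFA heA
  have hFfA : F * f ∈ A := mul_mem hFA hfA
  have hEsum : E = F * e + (e - F * e) + p₃ := by rw [he]; abel
  obtain ⟨w, hwA, -, hwp, hwker, hwker'⟩ := exists_polar (mul_mem hFA hEA)
  have hwv := mul_eq_self_of_isIdempotentElem_star_mul hwp.isIdempotentElem
  have hww : ∀ x, (star w * w) x = 0 ↔ w x = 0 := fun x =>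
    ⟨fun hx => by rw [← hwv, mul_apply_eq_comp, hx, map_zero],
      fun hx => by rw [mul_apply_eq_comp, hx, map_zero]⟩
  have hww' : ∀ x, (w * star w) x = 0 ↔ star w x = 0 := fun x =>
    ⟨fun hx => by
      have h1 : star w = star w * (w * star w) := by
        have := congrArg star hwv
        simp only [star_mul, star_star] at this
        rw [← mul_assoc, this]
      rw [h1, mul_apply_eq_comp, hx, map_zero],
      fun hx => by rw [mul_apply_eq_comp, hx, map_zero]⟩
  have app : ∀ {S T : H →L[ℂ] H}, S = T → ∀ x, S x = T x := fun h x => by rw [h]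
  refine ⟨F * e, hFeA, e - F * e, sub_mem heA hFeA, p₃, hp₃A, f - F * f, sub_mem hfA hFfA, F * f,
    hFfA, v, hvA, h, hh ▸ mul_mem (mul_mem hp₃A hFA) hp₃A, w, hwA, hFe, hp₂, hvp, hp₄, hFf,
    hp₃.symm, ?_, hnn, hle, ?_, ?_, hEsum, ?_, ?_, ?_, ?_, ?_⟩
  · rw [← hq₃, hf, he]
    noncomm_ring
  · intro x hx hhx
    -- On the range of `p₃`, `⟪hx, x⟫ = ⟪Fx, x⟫ = ‖Fx‖²`. Hence `hx = 0` forces `Fx = 0`, then `Xx =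
    -- 0` and `p₃x = 0`; the argument for `p₃ - h` uses `1 - F` instead.
    have h1 : F x = 0 := apply_eq_zero_of_inner hF (by
      have : ⟪h x, x⟫_ℂ = ⟪F x, x⟫_ℂ := by
        rw [hh, mul_apply_eq_comp, mul_apply_eq_comp, hx]
        nth_rw 1 [← p3s]
        rw [ContinuousLinearMap.star_eq_adjoint, ContinuousLinearMap.adjoint_inner_left, hx]
      rw [← this, hhx, inner_zero_left])
    have h2 := app Fp3 x
    rw [mul_apply_eq_comp, hx, h1, add_apply, hhx, zero_add] at h2
    have h3 := (hker x).1 h2.symm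
    rw [← hx, hp₃, mul_apply_eq_comp, h3, map_zero]
  · intro x hx hhx
    have hhx' : x = h x := by rwa [sub_apply, hx, sub_eq_zero] at hhx
    have h1 : (1 - F) x = 0 := apply_eq_zero_of_inner hF.one_sub (by
      have : ⟪h x, x⟫_ℂ = ⟪F x, x⟫_ℂ := by
        rw [hh, mul_apply_eq_comp, mul_apply_eq_comp, hx]
        nth_rw 1 [← p3s]
        rw [ContinuousLinearMap.star_eq_adjoint, ContinuousLinearMap.adjoint_inner_left, hx]
      rw [sub_apply, inner_sub_left, ← this, ← hhx', one_apply_eq_self, sub_self])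
    rw [sub_apply, one_apply_eq_self, sub_eq_zero] at h1
    have h2 := app Fp3 x
    rw [mul_apply_eq_comp, hx, ← h1, add_apply, ← hhx', left_eq_add] at h2
    have h3 := (hker x).1 h2
    rw [← hx, hp₃, mul_apply_eq_comp, h3, map_zero]
  · rw [hsq]
    have h1 : F = F * (e + f + q₃) + F * p₃ := by rw [he, hf]; noncomm_ring
    rw [hXv] at Fp3
    linear_combination (norm := (rw [hq₃]; noncomm_ring)) h1 + Fp3 + Fv * star v
  · rw [mul_sub, Ee, EFe]
  · rw [← mul_assoc, FF]
  · refine IsStarProjection.eq_of_apply_eq_zero_iff hwp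
      (hp₂.sub_of_mul_eq_right hE (by rw [mul_sub, Ee, EFe])) fun x => ?_
    rw [hww, ← hwker]
    constructor
    · intro hx
      have h1 : (F * e) x = 0 := by
        have h2 : F * e = e * (F * E) := by rw [← mul_assoc, eF, mul_assoc, eE]
        rw [h2, mul_apply_eq_comp, hx, map_zero]
      have h2 : p₃ x = 0 := by
        have h3 : X x = 0 := by rw [hX, mul_assoc, mul_apply_eq_comp, hx, map_zero]
        rw [hp₃, mul_apply_eq_comp, (hker x).1 h3, map_zero]
      have h3 : E - (e - F * e) = p₃ + F * e := by rw [he]; abel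
      rw [h3, add_apply, h1, h2, add_zero]
    · intro hx
      have h1 : F * E = F * (E - (e - F * e)) := by
        linear_combination (norm := noncomm_ring) -(FF * e)
      rw [h1, mul_apply_eq_comp, hx, map_zero]
  · refine IsStarProjection.eq_of_apply_eq_zero_iff (isStarProjection_mul_star hwp)
      (hFf.sub_of_mul_eq_right hF (by rw [← mul_assoc, FF])) fun x => ?_
    rw [hww', ← hwker', star_mul, Es, Fs]
    constructor
    · intro hx
      have h1 : q₃ (F x) = 0 := by
        have h2 : star X * F = E * F - E * F * (E * F) := by
          rw [hXs]
          linear_combination (norm := noncomm_ring) E * FF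
        have h3 : star X (F x) = 0 := by
          rw [← mul_apply_eq_comp, h2, sub_apply, mul_apply_eq_comp (E * F), hx, map_zero, sub_zero]
        rw [hq₃, mul_apply_eq_comp, (hker' _).1 h3, map_zero]
      have h2 : F - F * f = E * F + q₃ * F := by rw [← fF, hf]; noncomm_ring
      rw [h2, add_apply, hx, mul_apply_eq_comp, h1, add_zero]
    · intro hx
      have h1 : E * F = E * (F - F * f) := by rw [mul_sub, EFf, sub_zero]
      rw [h1, mul_apply_eq_comp, hx, map_zero]

end Halmos

/-! ### Finiteness, and maximal partial isometries. -/

section Comparison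

open Filter Topology

variable {H : Type*} [NormedAddCommGroup H] [InnerProductSpace ℂ H] [CompleteSpace H]

theorem mul_star_eq_one_of_isFiniteAlg {A : VonNeumannAlgebra H} (hA : A.IsFiniteAlg)
    {M : H →L[ℂ] H} (hM : M ∈ A) (h : star M * M = 1) : M * star M = 1 := by
  have hp : IsStarProjection (M * star M) := isStarProjection_mul_star (by
    rw [h]; exact .one _)
  let N : A := ⟨M * star M, mul_mem hM (star_mem hM)⟩
  have hN : IsStarProjection N :=
    ⟨Subtype.ext hp.isIdempotentElem.eq, Subtype.ext hp.isSelfAdjoint.star_eq⟩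
  have := hA.2 N hN (one_mul N) ⟨⟨M, hM⟩, Subtype.ext h, rfl⟩
  exact congrArg Subtype.val this

/-- Finiteness passes to the corner of `e`: adding `1 - e` to `m` gives an isometry of the whole
algebra, which must be unitary. -/
theorem mul_star_eq_of_isFiniteAlg {A : VonNeumannAlgebra H} (hA : A.IsFiniteAlg)
    {e m : H →L[ℂ] H} (he : IsStarProjection e) (hm : m ∈ A) (hem : e * m = m)
    (h : star m * m = e) : m * star m = e := by
  have hme : m * e = m := by
    rw [← h]; exact mul_eq_self_of_isIdempotentElem_star_mul (h ▸ he.isIdempotentElem)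
  have es : star e = e := he.isSelfAdjoint
  have ee : e * e = e := he.isIdempotentElem
  have hme' : star m * e = star m := by
    have := congrArg star hem
    rwa [star_mul, es] at this
  have hem' : e * star m = star m := by
    have := congrArg star hme
    rwa [star_mul, es] at this
  have heA : e ∈ A := h ▸ mul_mem (star_mem hm) hm
  have := mul_star_eq_one_of_isFiniteAlg hA (M := m + (1 - e))
    (add_mem hm (sub_mem (one_mem A) heA)) (by
      rw [star_add, star_sub, star_one, es]
      linear_combination (norm := noncomm_ring) h - hme' - hem + ee)
  rw [star_add, star_sub, star_one, es] at this
  linear_combination (norm := noncomm_ring) this + hme + hem' - ee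

theorem norm_apply_of_isStarProjection_star_mul {v : H →L[ℂ] H} (h : IsStarProjection (star v * v))
    (x : H) : ‖v x‖ = ‖(star v * v) x‖ := by
  have h1 : ((‖v x‖ : ℂ)) ^ 2 = ⟪(star v * v) x, x⟫_ℂ := by
    rw [mul_apply_eq_comp, ContinuousLinearMap.star_eq_adjoint,
      ContinuousLinearMap.adjoint_inner_left, inner_self_eq_norm_sq_to_K]
    rfl
  rw [← norm_sq_apply_of_isStarProjection h] at h1
  have h2 : ‖v x‖ ^ 2 = ‖(star v * v) x‖ ^ 2 := by exact_mod_cast h1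
  exact (sq_eq_sq₀ (norm_nonneg _) (norm_nonneg _)).1 h2

theorem norm_apply_le_of_isStarProjection {p : H →L[ℂ] H} (hp : IsStarProjection p) (x : H) :
    ‖p x‖ ≤ ‖x‖ := by
  have h1 : ‖p x‖ ^ 2 ≤ ‖p x‖ * ‖x‖ := by
    have h := congrArg norm (norm_sq_apply_of_isStarProjection hp x)
    rw [norm_pow, Complex.norm_real, norm_norm] at h
    rw [h]
    exact norm_inner_le_norm _ _
  by_contra! hlt
  nlinarith [norm_nonneg x]

/-- The partial isometry `w` extends the partial isometry `v`. -/
def Extends (w v : H →L[ℂ] H) : Prop := w * (star v * v) = v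

/-- With `p`, `q` the initial projections of `v`, `w`, the relation `wp = v` gives `pqp = p`, so `(1
- q)p = 0` by the C*-identity. -/
theorem Extends.init_mul {w v : H →L[ℂ] H} (h : Extends w v) (hv : IsStarProjection (star v * v))
    (hw : IsStarProjection (star w * w)) : star w * w * (star v * v) = star v * v := by
  obtain ⟨p, hp⟩ : ∃ p, p = star v * v := ⟨_, rfl⟩
  obtain ⟨q, hq⟩ : ∃ q, q = star w * w := ⟨_, rfl⟩
  rw [Extends] at h
  rw [← hp] at hv h ⊢
  rw [← hq] at hw ⊢
  have ps : star p = p := hv.isSelfAdjoint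
  have pp : p * p = p := hv.isIdempotentElem
  have hpqp : p * q * p = p := by
    nth_rw 3 [hp]
    rw [← h, star_mul, ps, hq]
    simp only [mul_assoc]
  have : (1 - q) * p = 0 := by
    rw [← CStarRing.star_mul_self_eq_zero_iff, star_mul, hw.one_sub.isSelfAdjoint.star_eq, ps]
    have qq : (1 - q) * (1 - q) = 1 - q := hw.one_sub.isIdempotentElem
    linear_combination (norm := noncomm_ring) p * qq * p + pp - hpqp
  rw [sub_mul, one_mul, sub_eq_zero] at this
  exact this.symm

theorem Extends.trans {u w v : H →L[ℂ] H} (h : Extends w v) (h' : Extends u w)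
    (hv : IsStarProjection (star v * v)) (hw : IsStarProjection (star w * w)) : Extends u v := by
  rw [Extends, ← h.init_mul hv hw, ← mul_assoc, h', h]

/-- Pythagoras: `star v * w = star v * v` makes `wx - vx` orthogonal to `vx`. -/
theorem Extends.norm_sub_sq {w v : H →L[ℂ] H} (h : Extends w v)
    (hv : IsStarProjection (star v * v)) (hw : IsStarProjection (star w * w)) (x : H) :
    ‖w x - v x‖ ^ 2 = ‖w x‖ ^ 2 - ‖v x‖ ^ 2 := by
  have h1 : star v * w = star v * v := by
    have h2 := congrArg star (h.init_mul hv hw)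
    have h3 := congrArg star h
    rw [star_mul, hv.isSelfAdjoint.star_eq] at h3
    rw [star_mul, hv.isSelfAdjoint.star_eq, hw.isSelfAdjoint.star_eq] at h2
    calc star v * w = star v * v * star w * w := by rw [h3]
      _ = star v * v := by rw [mul_assoc, h2]
  have h2 : ⟪v x, w x⟫_ℂ = ⟪v x, v x⟫_ℂ := by
    rw [← ContinuousLinearMap.adjoint_inner_right, ← ContinuousLinearMap.adjoint_inner_right,
      ← ContinuousLinearMap.star_eq_adjoint, ← mul_apply_eq_comp, h1]
    rfl
  have h3 := _root_.norm_sub_sq (𝕜 := ℂ) (w x) (v x)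
  rw [← inner_conj_symm, h2, inner_conj_symm] at h3
  rw [h3, inner_self_eq_norm_sq]
  ring

/-- Every chain of partial isometries of a von Neumann algebra has a least upper bound, its strong
limit. -/
theorem exists_extends_of_chain {A : VonNeumannAlgebra H} {p q : H →L[ℂ] H} {ι : Type*}
    [Preorder ι] [IsDirectedOrder ι] [Nonempty ι] (v : ι → H →L[ℂ] H) (hvA : ∀ i, v i ∈ A)
    (hv : ∀ i, IsStarProjection (star (v i) * v i)) (hp : ∀ i, v i * p = v i)
    (hq : ∀ i, q * v i = v i) (hmono : ∀ i j, i ≤ j → Extends (v j) (v i)) :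
    ∃ w ∈ A, IsStarProjection (star w * w) ∧ w * p = w ∧ q * w = w ∧ ∀ i, Extends w (v i) := by
  have hle : ∀ i x, ‖v i x‖ ≤ ‖x‖ := fun i x => by
    rw [norm_apply_of_isStarProjection_star_mul (hv i)]
    exact norm_apply_le_of_isStarProjection (hv i) x
  -- Along the chain `‖v i x‖²` increases and is bounded by `‖x‖²`, and by `Extends.norm_sub_sq` its
  -- increments are the squared distances; so the net is Cauchy.
  have hlim : ∀ x, ∃ y, Tendsto (fun i => v i x) atTop (𝓝 y) := by
    intro x
    refine cauchy_map_iff_exists_tendsto.1 (Metric.cauchy_iff.2 ⟨map_neBot, fun ε hε => ?_⟩)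
    have hbdd : BddAbove (Set.range fun i => ‖v i x‖ ^ 2) := ⟨‖x‖ ^ 2, by
      rintro _ ⟨i, rfl⟩
      exact pow_le_pow_left₀ (norm_nonneg _) (hle i x) 2⟩
    obtain ⟨i, hi⟩ := exists_lt_of_lt_ciSup (f := fun i => ‖v i x‖ ^ 2)
      (sub_lt_self (⨆ i, ‖v i x‖ ^ 2) (show 0 < (ε / 2) ^ 2 by positivity))
    have hd : ∀ j, i ≤ j → dist (v j x) (v i x) < ε / 2 := by
      intro j hij
      rw [dist_eq_norm]
      refine lt_of_pow_lt_pow_left₀ 2 (by positivity) ?_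
      rw [(hmono i j hij).norm_sub_sq (hv i) (hv j)]
      have := le_ciSup hbdd j
      linarith
    refine ⟨(fun j => v j x) '' Set.Ici i, image_mem_map (Ici_mem_atTop i), ?_⟩
    rintro _ ⟨j, hj, rfl⟩ _ ⟨k, hk, rfl⟩
    calc dist (v j x) (v k x) ≤ dist (v j x) (v i x) + dist (v k x) (v i x) :=
          dist_triangle_right _ _ _
      _ < ε / 2 + ε / 2 := add_lt_add (hd j hj) (hd k hk)
      _ = ε := add_halves ε
  choose f hf using hlim
  let w : H →L[ℂ] H := ContinuousLinearMap.ofTendstoOfBoundedRange f v (tendsto_pi_nhds.2 hf) (by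
    refine isBounded_iff_forall_norm_le.2 ⟨1, ?_⟩
    rintro _ ⟨i, rfl⟩
    exact ContinuousLinearMap.opNorm_le_bound _ zero_le_one fun x => by
      rw [one_mul]; exact hle i x)
  have hw : ∀ x, Tendsto (fun i => v i x) atTop (𝓝 (w x)) := hf
  have hwv : ∀ i, Extends w (v i) := by
    intro i
    ext x
    refine tendsto_nhds_unique (hw ((star (v i) * v i) x)) ?_
    refine tendsto_const_nhds.congr' ?_
    filter_upwards [Ici_mem_atTop i] with j hj
    exact (congrArg (fun f : H →L[ℂ] H => f x) (hmono i j hj)).symm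
  have hswv : ∀ i, star w * v i = star (v i) * v i := by
    intro i
    ext x
    refine ext_inner_right ℂ fun y => ?_
    rw [mul_apply_eq_comp, ContinuousLinearMap.star_eq_adjoint,
      ContinuousLinearMap.adjoint_inner_left]
    refine tendsto_nhds_unique (tendsto_const_nhds.inner (hw y)) ?_
    refine tendsto_const_nhds.congr' ?_
    filter_upwards [Ici_mem_atTop i] with j hj
    have h1 := (hmono i j hj)
    rw [← ContinuousLinearMap.adjoint_inner_left, ← ContinuousLinearMap.star_eq_adjoint,
      ← mul_apply_eq_comp]
    congr 2
    rw [← h1.init_mul (hv i) (hv j), mul_assoc, h1]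
  have hwww : w * (star w * w) = w := by
    ext x
    refine tendsto_nhds_unique (hw ((star w * w) x)) ((hw x).congr fun i => ?_)
    rw [← mul_apply_eq_comp]
    congr 1
    have h1 : star w * w * (star (v i) * v i) = star (v i) * v i := by
      rw [mul_assoc, hwv, hswv]
    have h2 := congrArg star h1
    simp only [star_mul, star_star] at h2
    rw [← mul_eq_self_of_isIdempotentElem_star_mul (hv i).isIdempotentElem, mul_assoc, h2]
  refine ⟨w, mem_of_forall_commute fun S hS x => ?_, ⟨?_, .star_mul_self w⟩, ?_, ?_, hwv⟩
  · refine tendsto_nhds_unique ((S.continuous.tendsto _).comp (hw x)) ((hw (S x)).congr fun i => ?_)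
    exact (commute_apply hS (hvA i) x).symm
  · rw [IsIdempotentElem, mul_assoc, hwww]
  · ext x
    refine tendsto_nhds_unique (hw (p x)) ((hw x).congr fun i => ?_)
    rw [← mul_apply_eq_comp, hp]
  · ext x
    refine tendsto_nhds_unique ((q.continuous.tendsto _).comp (hw x)) ((hw x).congr fun i => ?_)
    exact (congrArg (fun f : H →L[ℂ] H => f x) (hq i)).symm

/-- The partial isometries of `A` with initial projection below `p` and final projection below
`q`. -/
structure PartialIsometryBetween (A : VonNeumannAlgebra H) (p q : H →L[ℂ] H) where
  /-- The underlying operator. -/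
  toFun : H →L[ℂ] H
  mem : toFun ∈ A
  init : IsStarProjection (star toFun * toFun)
  mul_right : toFun * p = toFun
  mul_left : q * toFun = toFun

instance (A : VonNeumannAlgebra H) (p q : H →L[ℂ] H) : Preorder (PartialIsometryBetween A p q) where
  le v w := Extends w.toFun v.toFun
  le_refl v := mul_eq_self_of_isIdempotentElem_star_mul v.init.isIdempotentElem
  le_trans u v _ huv hvw := huv.trans hvw u.init v.init

/-- Zorn's lemma for extension of partial isometries. Strong limits bound nonempty chains; `0`
bounds the empty one. -/
theorem exists_maximal_partialIsometry (A : VonNeumannAlgebra H) (p q : H →L[ℂ] H) :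
    ∃ v ∈ A, IsStarProjection (star v * v) ∧ v * p = v ∧ q * v = v ∧
      ∀ w ∈ A, IsStarProjection (star w * w) → w * p = w → q * w = w → Extends w v →
        Extends v w := by
  obtain ⟨m, hm⟩ := zorn_le (α := PartialIsometryBetween A p q) (fun c hc => by
    rcases c.eq_empty_or_nonempty with rfl | hne
    · exact ⟨⟨0, zero_mem _, by simp [IsStarProjection.zero], by simp, by simp⟩,
        fun _ h => h.elim⟩
    · have : Nonempty c := hne.to_subtype
      have : IsDirectedOrder c := directedOn_iff_isDirectedOrder.1 hc.directedOn
      obtain ⟨w, h1, h2, h3, h4, h5⟩ := exists_extends_of_chain (A := A) (p := p) (q := q)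
        (ι := c) (fun i => i.1.toFun) (fun i => i.1.mem) (fun i => i.1.init)
        (fun i => i.1.mul_right) (fun i => i.1.mul_left) (fun i j h => h)
      exact ⟨⟨w, h1, h2, h3, h4⟩, fun v hv => h5 ⟨v, hv⟩⟩)
  exact ⟨m.toFun, m.mem, m.init, m.mul_right, m.mul_left, fun w h1 h2 h3 h4 h5 =>
    hm (b := ⟨w, h1, h2, h3, h4⟩) h5⟩

end Comparison

/-! ### Cancellation of equivalent projections; existence of the normal form. -/

section Cancellation

variable {H : Type*} [NormedAddCommGroup H] [InnerProductSpace ℂ H] [CompleteSpace H]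

/-- The closed subspace of all `x` with `q a x = 0` for every `a ∈ A` is invariant under both `A`
and its commutant, so its projection is central; it contains the range of `p` and is annihilated by
`q`. -/
theorem exists_central_separation (A : VonNeumannAlgebra H) {p q : H →L[ℂ] H}
    (hq : q ∈ A) (h : ∀ a ∈ A, q * a * p = 0) :
    ∃ z ∈ A, z ∈ A.commutant ∧ IsStarProjection z ∧ z * p = p ∧ q * z = 0 := by
  let K : Submodule ℂ H := ⨅ a : A, (q * a : H →L[ℂ] H).ker
  have hK : ∀ x, x ∈ K ↔ ∀ a ∈ A, q (a x) = 0 := by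
    intro x
    simp only [K, Submodule.mem_iInf, Subtype.forall]
    rfl
  have hcl : IsClosed (K : Set H) := by
    have : (K : Set H) = ⋂ a : A, {x | q ((a : H →L[ℂ] H) x) = 0} := by
      ext x
      simp [hK]
    rw [this]
    exact isClosed_iInter fun a => isClosed_eq (by fun_prop) (by fun_prop)
  have : CompleteSpace K := hcl.completeSpace_coe
  refine ⟨K.starProjection, starProjection_mem fun S hS x hx => ?_,
    starProjection_mem fun S hS x hx => ?_, isStarProjection_starProjection, ?_, ?_⟩
  · rw [hK] at hx ⊢
    exact fun a ha => by rw [← commute_apply hS ha, ← commute_apply hS hq, hx a ha, map_zero]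
  · rw [commutant_commutant] at hS
    rw [hK] at hx ⊢
    exact fun a ha => hx _ (mul_mem ha hS)
  · ext x
    refine Submodule.starProjection_eq_self_iff.2 ((hK _).2 fun a ha => ?_)
    exact congrArg (fun f : H →L[ℂ] H => f x) (h a ha)
  · ext x
    exact (hK _).1 (Submodule.starProjection_apply_mem K x) 1 (one_mem A)

/-- A maximal partial isometry `v` from `p` to `q` leaves remainders `p'`, `q'` that a central `z`
separates: `z p' = p'`, `z q' = 0`. Then `c = w + v` carries `E - p'` to `F - q'`. Going from `E` to
`F` by `u` and back by `star c` embeds `zE` onto `zE - p'`, so finiteness gives `p' = 0`; then `c *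
star u` embeds `F` onto `F - q'`, so `q' = 0`. -/
theorem exists_mvn_of_sub {A : VonNeumannAlgebra H} (hA : A.IsFiniteAlg) {E F p q u w : H →L[ℂ] H}
    (hpA : p ∈ A) (hqA : q ∈ A) (huA : u ∈ A) (hwA : w ∈ A)
    (hE : IsStarProjection E) (hF : IsStarProjection F) (hp : IsStarProjection p)
    (hq : IsStarProjection q) (hEp : E * p = p) (hFq : F * q = q) (hu : star u * u = E)
    (hu' : u * star u = F) (hw : star w * w = E - p) (hw' : w * star w = F - q) :
    ∃ v ∈ A, star v * v = p ∧ v * star v = q := by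
  have Es : star E = E := hE.isSelfAdjoint
  have Fs : star F = F := hF.isSelfAdjoint
  have EE : E * E = E := hE.isIdempotentElem
  have FF : F * F = F := hF.isIdempotentElem
  have ps : star p = p := hp.isSelfAdjoint
  have qs : star q = q := hq.isSelfAdjoint
  have qq : q * q = q := hq.isIdempotentElem
  have hEA : E ∈ A := hu ▸ mul_mem (star_mem huA) huA
  have pE : p * E = p := by
    have := congrArg star hEp
    rwa [star_mul, ps, Es] at this
  have qF : q * F = q := by
    have := congrArg star hFq
    rwa [star_mul, qs, Fs] at this
  obtain ⟨v, hvA, hv, hvp, hqv, hmax⟩ := exists_maximal_partialIsometry A p q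
  have hvv := mul_eq_self_of_isIdempotentElem_star_mul hv.isIdempotentElem
  have pvs : p * star v = star v := by
    have := congrArg star hvp
    rwa [star_mul, ps] at this
  have vsq : star v * q = star v := by
    have := congrArg star hqv
    rwa [star_mul, qs] at this
  obtain ⟨p', hp'⟩ : ∃ p', p' = p - star v * v := ⟨_, rfl⟩
  obtain ⟨q', hq'⟩ : ∃ q', q' = q - v * star v := ⟨_, rfl⟩
  have hp'p : IsStarProjection p' := hp' ▸ hv.sub_of_mul_eq_right hp (by rw [← mul_assoc, pvs])
  have hq'p : IsStarProjection q' := hq' ▸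
    (isStarProjection_mul_star hv).sub_of_mul_eq_right hq (by rw [← mul_assoc, hqv])
  have ps' : star p' = p' := hp'p.isSelfAdjoint
  have qs' : star q' = q' := hq'p.isSelfAdjoint
  have hp'A : p' ∈ A := hp' ▸ sub_mem hpA (mul_mem (star_mem hvA) hvA)
  have hq'A : q' ∈ A := hq' ▸ sub_mem hqA (mul_mem hvA (star_mem hvA))
  have vp' : v * p' = 0 := by rw [hp', mul_sub, hvp, hvv, sub_self]
  have q'v : q' * v = 0 := by rw [hq', sub_mul, hqv, mul_assoc, hvv, sub_self]
  have p'vs : p' * star v = 0 := by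
    have := congrArg star vp'
    rwa [star_mul, ps', star_zero] at this
  have vsq' : star v * q' = 0 := by
    have := congrArg star q'v
    rwa [star_mul, qs', star_zero] at this
  -- by maximality there is nothing between the remainders
  have hsep : ∀ a ∈ A, q' * a * p' = 0 := by
    intro a ha
    obtain ⟨X, hX⟩ : ∃ X, X = q' * a * p' := ⟨_, rfl⟩
    rw [← hX]
    have hXA : X ∈ A := hX ▸ mul_mem (mul_mem hq'A ha) hp'A
    obtain ⟨t, htA, hXt, htp, hk, hk'⟩ := exists_polar hXA
    have tp : t * p' = t := by
      have := mul_eq_zero_of_ker (fun x => (hk x).1) (Y := 1 - p') (by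
        rw [hX, mul_assoc, hp'p.mul_one_sub_self, mul_zero])
      rw [mul_sub, mul_one, sub_eq_zero] at this
      exact this.symm
    have tq : star t * q' = star t := by
      have := mul_eq_zero_of_ker (fun x => (hk' x).1) (Y := 1 - q') (by
        rw [hX, star_mul, star_mul, qs', mul_assoc, mul_assoc, hq'p.mul_one_sub_self, mul_zero,
          mul_zero])
      rw [mul_sub, mul_one, sub_eq_zero] at this
      exact this.symm
    have qt : q' * t = t := by
      have := congrArg star tq
      rwa [star_mul, qs', star_star] at this
    have pt : p' * star t = star t := by
      have := congrArg star tp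
      rwa [star_mul, ps'] at this
    have vt : star v * t = 0 := by rw [← qt, ← mul_assoc, vsq', zero_mul]
    have tv : star t * v = 0 := by rw [← tq, mul_assoc, q'v, mul_zero]
    have vts : v * star t = 0 := by rw [← pt, ← mul_assoc, vp', zero_mul]
    have tvs : t * star v = 0 := by rw [← tp, mul_assoc, p'vs, mul_zero]
    have hsum : star (v + t) * (v + t) = star v * v + star t * t := by
      rw [star_add, mul_add, add_mul, add_mul, vt, tv]
      abel
    have hpp : p * p' = p' := by rw [hp', mul_sub, hp.isIdempotentElem.eq, ← mul_assoc, pvs]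
    have hp'p2 : p' * p = p' := by
      have := congrArg star hpp
      rwa [star_mul, ps, ps'] at this
    have hqq' : q * q' = q' := by rw [hq', mul_sub, qq, ← mul_assoc, hqv]
    -- A nonzero `q' a p'` would have a nonzero polar part `t`, and `v + t` would properly extend
    -- `v`.
    have h1 : Extends v (v + t) := by
      refine hmax _ (add_mem hvA htA) ?_ ?_ ?_ ?_
      · rw [hsum]
        exact hv.add htp (by rw [mul_assoc, ← mul_assoc v, vts, zero_mul, mul_zero])
      · rw [add_mul, hvp, ← tp, mul_assoc, hp'p2]
      · rw [mul_add, hqv, ← qt, ← mul_assoc, hqq']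
      · rw [Extends, add_mul, hvv, ← mul_assoc, tvs, zero_mul, add_zero]
    rw [Extends, hsum, mul_add, hvv, ← mul_assoc, vts, zero_mul, add_zero, left_eq_add] at h1
    rw [hXt, h1, zero_mul]
  obtain ⟨z, hzA, hzA', hz, zp', q'z⟩ := exists_central_separation A hq'A hsep
  have zs : star z = z := hz.isSelfAdjoint
  have zz : z * z = z := hz.isIdempotentElem
  have hzc : ∀ a ∈ A, a * z = z * a := fun a ha => mem_commutant_iff.1 hzA' a ha
  have zq' : z * q' = 0 := by rw [← hzc q' hq'A, q'z]
  -- `c` identifies `E - p'` with `F - q'`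
  obtain ⟨c, hc⟩ : ∃ c, c = w + v := ⟨_, rfl⟩
  have hcA : c ∈ A := hc ▸ add_mem hwA hvA
  have hwp : IsStarProjection (star w * w) := by
    rw [hw]; exact hp.sub_of_mul_eq_right hE hEp
  have hww := mul_eq_self_of_isIdempotentElem_star_mul hwp.isIdempotentElem
  have wp : w * p = 0 := by
    rw [← hww, hw, mul_assoc, sub_mul, hEp, hp.isIdempotentElem.eq, sub_self, mul_zero]
  have Fw : F * w = w := by
    have : w * star w * w = w := by rw [mul_assoc, hww]
    rw [← this, hw', ← mul_assoc, mul_sub, FF, hFq]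
  have qw : q * w = 0 := by
    have : w * star w * w = w := by rw [mul_assoc, hww]
    rw [← this, hw', ← mul_assoc, mul_sub, qF, qq, sub_self, zero_mul]
  have wv : star w * v = 0 := by
    have := congrArg star qw
    rw [star_mul, qs, star_zero] at this
    rw [← hqv, ← mul_assoc, this, zero_mul]
  have vw : star v * w = 0 := by
    have := congrArg star wv
    rwa [star_mul, star_star, star_zero] at this
  have wvs : w * star v = 0 := by rw [← pvs, ← mul_assoc, wp, zero_mul]
  have vws : v * star w = 0 := by
    have := congrArg star wvs
    rwa [star_mul, star_star, star_zero] at this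
  have hcc : star c * c = E - p' := by
    rw [hc, hp', star_add, mul_add, add_mul, add_mul, wv, vw, hw]
    abel
  have hcc' : c * star c = F - q' := by
    rw [hc, hq', star_add, mul_add, add_mul, add_mul, wvs, vws, hw']
    abel
  have Fc : F * c = c := by rw [hc, mul_add, Fw, ← hqv, ← mul_assoc, hFq]
  have csF : star c * F = star c := by
    have := congrArg star Fc
    rwa [star_mul, Fs] at this
  have up : IsStarProjection (star u * u) := hu ▸ hE
  have uE : u * E = u := hu ▸ mul_eq_self_of_isIdempotentElem_star_mul up.isIdempotentElem
  have Fu : F * u = u := by rw [← hu', mul_assoc, hu, uE]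
  have Eus : E * star u = star u := by
    have := congrArg star uE
    rwa [star_mul, Es] at this
  have usF : star u * F = star u := by
    have := congrArg star Fu
    rwa [star_mul, Fs] at this
  have cE : c * E = c := by
    have h1 : w * E = w := by
      rw [← hww, hw, mul_assoc, sub_mul, EE, pE]
    rw [hc, add_mul, h1, ← hvp, mul_assoc, pE]
  have Ecs : E * star c = star c := by
    have := congrArg star cE
    rwa [star_mul, Es] at this
  have hp'0 : p' = 0 := by
    have hmA : z * star c * u ∈ A := mul_mem (mul_mem hzA (star_mem hcA)) huA
    have hms : star (z * star c * u) = star u * c * z := by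
      rw [star_mul, star_mul, star_star, zs, mul_assoc]
    have h1 : star (z * star c * u) * (z * star c * u) = z * E := by
      rw [hms]
      calc star u * c * z * (z * star c * u) = star u * (c * (z * z)) * star c * u := by
            simp only [mul_assoc]
        _ = star u * (z * (c * star c)) * u := by rw [zz, hzc c hcA]; simp only [mul_assoc]
        _ = star u * z * F * u := by rw [hcc', mul_sub, zq', sub_zero]; simp only [mul_assoc]
        _ = z * star u * (F * u) := by rw [hzc _ (star_mem huA)]; simp only [mul_assoc]
        _ = z * E := by rw [Fu, mul_assoc, hu]
    have h2 : z * star c * u * star (z * star c * u) = z * E - p' := by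
      rw [hms]
      calc z * star c * u * (star u * c * z) = z * star c * (u * star u) * (c * z) := by
            simp only [mul_assoc]
        _ = z * (star c * F) * (c * z) := by rw [hu']; simp only [mul_assoc]
        _ = z * (star c * c * z) := by rw [csF]; simp only [mul_assoc]
        _ = z * z * (star c * c) := by
          rw [hzc _ (mul_mem (star_mem hcA) hcA)]; simp only [mul_assoc]
        _ = z * E - p' := by rw [zz, hcc, mul_sub, zp']
    have h3 := mul_star_eq_of_isFiniteAlg hA (hz.mul hE (hzc E hEA).symm) hmA (by
      calc z * E * (z * star c * u) = z * (E * z) * star c * u := by simp only [mul_assoc]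
        _ = z * z * (E * star c) * u := by rw [hzc E hEA]; simp only [mul_assoc]
        _ = z * star c * u := by rw [zz, Ecs]) h1
    rw [h2, sub_eq_self] at h3
    exact h3
  have hq'0 : q' = 0 := by
    have h3 := mul_star_eq_of_isFiniteAlg hA (m := c * star u) hF (mul_mem hcA (star_mem huA))
      (by rw [← mul_assoc, Fc]) (by
        rw [star_mul, star_star]
        calc u * star c * (c * star u) = u * (star c * c) * star u := by simp only [mul_assoc]
          _ = F := by rw [hcc, hp'0, sub_zero, uE, hu'])
    have h4 : c * star u * star (c * star u) = F - q' := by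
      rw [star_mul, star_star]
      calc c * star u * (u * star c) = c * (star u * u) * star c := by simp only [mul_assoc]
        _ = F - q' := by rw [hu, cE, hcc']
    rw [h4, sub_eq_self] at h3
    exact h3
  exact ⟨v, hvA, (sub_eq_zero.1 (hp'.symm.trans hp'0)).symm,
    (sub_eq_zero.1 (hq'.symm.trans hq'0)).symm⟩

/-- The polar part `u` of `T` gives `E ∼ F`. With the equivalence of `E - p₂` and `F - q₂` from the
two-projection decomposition, cancellation produces the missing `v₂`. -/
theorem nonempty_twoProjForm {A : VonNeumannAlgebra H} (hA : A.IsFiniteAlg) {T : H →L[ℂ] H}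
    (hT : T ∈ A) : Nonempty (A.TwoProjForm (1 - kerProj T) (rangeProj T)) := by
  have hEA : 1 - kerProj T ∈ A := sub_mem (one_mem A) (kerProj_mem hT)
  have hE : IsStarProjection (1 - kerProj T) := isStarProjection_starProjection.one_sub
  have hF : IsStarProjection (rangeProj T) := isStarProjection_starProjection
  obtain ⟨u, huA, -, hup, hk, hk'⟩ := exists_polar hT
  have huv := mul_eq_self_of_isIdempotentElem_star_mul hup.isIdempotentElem
  have hu : star u * u = 1 - kerProj T := by
    refine IsStarProjection.eq_of_apply_eq_zero_iff hup hE fun x => ?_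
    rw [sub_apply, one_apply_eq_self]
    constructor
    · intro hx
      rw [kerProj_eq_self, sub_self]
      rw [hk, ← huv, mul_apply_eq_comp, hx, map_zero]
    · intro hx
      rw [mul_apply_eq_comp, (hk x).1, map_zero]
      rw [sub_eq_zero.1 hx, apply_kerProj]
  have hu' : u * star u = rangeProj T := by
    refine IsStarProjection.eq_of_apply_eq_zero_iff (isStarProjection_mul_star hup) hF fun x => ?_
    have h1 : star u * (u * star u) = star u := by
      have := congrArg star huv
      simp only [star_mul, star_star] at this
      rw [← mul_assoc, this]
    have h2 : rangeProj T x = 0 ↔ star T x = 0 := by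
      have : rangeProj T * T = T := by
        ext y
        exact rangeProj_apply T y
      constructor
      · intro hx
        rw [← this, star_mul, hF.isSelfAdjoint.star_eq, mul_apply_eq_comp, hx, map_zero]
      · intro hx
        refine (Submodule.starProjection_apply_eq_zero_iff _).2 ?_
        rw [Submodule.orthogonal_closure]
        rintro _ ⟨y, rfl⟩
        change ⟪T y, x⟫_ℂ = 0
        rw [← ContinuousLinearMap.adjoint_inner_right,
          ← ContinuousLinearMap.star_eq_adjoint, hx, inner_zero_right]
    rw [h2, hk']
    exact ⟨fun hx => by rw [← h1, mul_apply_eq_comp, hx, map_zero],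
      fun hx => by rw [mul_apply_eq_comp, hx, map_zero]⟩
  obtain ⟨p₁, h1A, p₂, h2A, p₃, h3A, p₄, h4A, q₂, q2A, v₃, v3A, h, hhA, w, hwA, hp1, hp2, hp3, hp4,
    hq2, hv3, hsum, h0, hle, hinj, hinj', hEeq, hFeq, hEp, hFq, hw, hw'⟩ :=
    exists_twoProj_decomposition hEA (rangeProj_mem hT) hE hF
  obtain ⟨v₂, v2A, hv2, rfl⟩ := exists_mvn_of_sub hA h2A q2A huA hwA hE hF hp2 hq2 hEp hFq hu hu'
    hw hw'
  exact ⟨⟨p₁, p₂, p₃, p₄, v₂, v₃, h, h1A, h2A, h3A, h4A, v2A, v3A, hhA, hp1, hp2, hp3, hp4, hv2,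
    hv3, hsum, h0, hle, hinj, hinj', hEeq, hFeq⟩⟩

theorem isStarCleanElem_of_isClosed_range {A : VonNeumannAlgebra H} (hA : A.IsFiniteAlg) (T : A)
    (hT : IsClosed (Set.range (T : H →L[ℂ] H))) : IsStarCleanElem T := by
  obtain ⟨D⟩ := nonempty_twoProjForm hA T.2
  obtain ⟨Q, -, hQ, hu⟩ := exists_isStarProjection_isUnit_sub T hT D
  exact ⟨T - Q, Q, hu, hQ, (sub_add_cancel T Q).symm⟩

end Cancellation

/-! ### Scalar matrices and the matrix units of a type `I_n` algebra. -/

section Matrices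

/-- The von Neumann algebra of all the bounded operators. -/
def full (H : Type*) [NormedAddCommGroup H] [InnerProductSpace ℂ H] [CompleteSpace H] :
    VonNeumannAlgebra H where
  toStarSubalgebra := ⊤
  centralizer_centralizer' := Set.eq_univ_of_forall fun _ _ hS => (hS _ trivial).symm

theorem mem_full {H : Type*} [NormedAddCommGroup H] [InnerProductSpace ℂ H] [CompleteSpace H]
    (T : H →L[ℂ] H) : T ∈ full H := trivial

/-- A one-sided inverse of a square matrix is two-sided. -/
theorem isFiniteAlg_full (n : ℕ) : (full (EuclideanSpace ℂ (Fin n))).IsFiniteAlg := by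
  refine ⟨.one _, ?_⟩
  rintro q - - ⟨v, h1, h2⟩
  let e := (Matrix.toEuclideanCLM (n := Fin n) (𝕜 := ℂ)).symm
  have h1' : star (v : EuclideanSpace ℂ (Fin n) →L[ℂ] EuclideanSpace ℂ (Fin n)) * v.1 = 1 :=
    congrArg Subtype.val h1
  have h2' : v.1 * star (v : EuclideanSpace ℂ (Fin n) →L[ℂ] EuclideanSpace ℂ (Fin n)) = q.1 :=
    congrArg Subtype.val h2
  have h3 : e (star v.1) * e v.1 = 1 := by rw [← map_mul, h1', map_one]
  have h4 : e v.1 * e (star v.1) = 1 := mul_eq_one_comm.1 h3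
  rw [← map_mul, h2', ← map_one e] at h4
  exact Subtype.ext (e.injective h4)

/-- Ranges in finite dimension are closed, so the closed range theorem applies to every matrix. -/
theorem isStarCleanElem_matrix {n : ℕ} (M : Matrix (Fin n) (Fin n) ℂ) : IsStarCleanElem M := by
  let e := Matrix.toEuclideanCLM (n := Fin n) (𝕜 := ℂ)
  have hc : IsClosed (Set.range (e M)) :=
    Submodule.closed_of_finiteDimensional (e M : EuclideanSpace ℂ (Fin n) →L[ℂ] _).range
  obtain ⟨u, p, hu, hp, h⟩ :=
    isStarCleanElem_of_isClosed_range (isFiniteAlg_full n) ⟨e M, mem_full _⟩ hc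
  have hu' : IsUnit (u : EuclideanSpace ℂ (Fin n) →L[ℂ] EuclideanSpace ℂ (Fin n)) := by
    obtain ⟨w, h1, h2⟩ := isUnit_iff_exists.1 hu
    exact isUnit_iff_exists.2 ⟨w, congrArg Subtype.val h1, congrArg Subtype.val h2⟩
  have hp' : IsStarProjection
      (p : EuclideanSpace ℂ (Fin n) →L[ℂ] EuclideanSpace ℂ (Fin n)) :=
    ⟨congrArg Subtype.val hp.isIdempotentElem, congrArg Subtype.val hp.isSelfAdjoint⟩
  refine ⟨e.symm u, e.symm p, hu'.map e.symm, ⟨?_, ?_⟩, ?_⟩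
  · rw [IsIdempotentElem, ← map_mul, hp'.isIdempotentElem.eq]
  · exact (e.symm.map_star' p.1).symm.trans (congrArg e.symm hp'.isSelfAdjoint.star_eq)
  rw [← map_add]
  exact (e.symm_apply_eq.2 (congrArg Subtype.val h).symm).symm

variable {H : Type*} [NormedAddCommGroup H] [InnerProductSpace ℂ H] [CompleteSpace H]

/-- Partial isometries `vᵢ` with a common abelian initial projection `p`, whose final projections
are mutually orthogonal and sum to `1`. -/
structure TypeIFrame (A : VonNeumannAlgebra H) (n : ℕ) where
  p : H →L[ℂ] H
  v : Fin n → H →L[ℂ] H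
  v_mem : ∀ i, v i ∈ A
  mul_p : ∀ i, v i * p = v i
  star_mul_self : ∀ i, star (v i) * v i = p
  star_mul_of_ne : ∀ i j, i ≠ j → star (v i) * v j = 0
  sum_eq_one : ∑ i, v i * star (v i) = 1
  comm : ∀ i j k l, ∀ S ∈ A, ∀ T ∈ A, star (v i) * S * v j * (star (v k) * T * v l) =
    star (v k) * T * v l * (star (v i) * S * v j)

theorem IsTypeI.nonempty_typeIFrame {A : VonNeumannAlgebra H} {n : ℕ} (h : A.IsTypeI n) :
    Nonempty (A.TypeIFrame n) := by
  obtain ⟨hn, q, hab, horth, hmvn, hsum⟩ := h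
  choose v hv hv' using hmvn ⟨0, hn⟩
  obtain ⟨p, hp⟩ : ∃ p : H →L[ℂ] H, p = q ⟨0, hn⟩ := ⟨_, rfl⟩
  have hvp : ∀ i, star (v i : H →L[ℂ] H) * v i = p := fun i => by
    rw [hp, ← hv i]; rfl
  have hvq : ∀ i, (v i : H →L[ℂ] H) * star (v i : H →L[ℂ] H) = q i := fun i => by
    rw [← hv' i]; rfl
  have hpp : IsStarProjection p := hp ▸
    ⟨congrArg Subtype.val (hab ⟨0, hn⟩).1.isIdempotentElem,
      congrArg Subtype.val (hab ⟨0, hn⟩).1.isSelfAdjoint⟩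
  have hmul : ∀ i, (v i : H →L[ℂ] H) * p = v i := fun i => by
    rw [← hvp i]
    exact mul_eq_self_of_isIdempotentElem_star_mul ((hvp i).symm ▸ hpp.isIdempotentElem)
  have hpm : ∀ i, p * star (v i : H →L[ℂ] H) = star (v i : H →L[ℂ] H) := fun i => by
    have := congrArg star (hmul i)
    rwa [star_mul, hpp.isSelfAdjoint.star_eq] at this
  refine ⟨⟨p, fun i => v i, fun i => (v i).2, hmul, hvp, fun i j hij => ?_, ?_, ?_⟩⟩
  · have h0 : (q i : H →L[ℂ] H) * q j = 0 := congrArg Subtype.val (horth i j hij)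
    rw [← hpm i, ← hvp i, ← hmul j, ← hvp j]
    calc star (v i : H →L[ℂ] H) * v i * star (v i : H →L[ℂ] H) *
          (v j * (star (v j : H →L[ℂ] H) * v j)) =
          star (v i : H →L[ℂ] H) * ((v i * star (v i : H →L[ℂ] H)) *
            (v j * star (v j : H →L[ℂ] H))) * v j := by simp only [mul_assoc]
      _ = 0 := by rw [hvq, hvq, h0, mul_zero, zero_mul]
  · simp_rw [hvq]
    have := congrArg (Subtype.val : A → H →L[ℂ] H) hsum
    exact (map_sum (SubringClass.subtype A) q Finset.univ).symm.trans this
  · intro i j k l S hS T hT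
    have key : ∀ i j, ∀ S : H →L[ℂ] H, star (v i : H →L[ℂ] H) * S * v j =
        p * (star (v i : H →L[ℂ] H) * S * v j) * p := fun i j S => by
      rw [← mul_assoc, ← mul_assoc, hpm, mul_assoc _ _ p, hmul]
    have hmem : ∀ i j, ∀ S ∈ A, star (v i : H →L[ℂ] H) * S * v j ∈ A := fun i j S hS =>
      mul_mem (mul_mem (star_mem (v i).2) hS) (v j).2
    have := congrArg Subtype.val ((hab ⟨0, hn⟩).2 ⟨_, hmem i j S hS⟩ ⟨_, hmem k l T hT⟩)
    rw [key i j, key k l, hp]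
    exact this

namespace TypeIFrame

variable {A : VonNeumannAlgebra H} {n : ℕ} (D : A.TypeIFrame n)

/-- The `*`-homomorphism given by the matrix units `vᵢvⱼ*`. -/
def ofMatrix (M : Matrix (Fin n) (Fin n) ℂ) : H →L[ℂ] H :=
  ∑ i, ∑ j, M i j • (D.v i * star (D.v j))

theorem ofMatrix_mem (M : Matrix (Fin n) (Fin n) ℂ) : D.ofMatrix M ∈ A :=
  sum_mem fun i _ => sum_mem fun j _ =>
    smul_mem' A _ (mul_mem (D.v_mem i) (star_mem (D.v_mem j)))

theorem ofMatrix_one : D.ofMatrix 1 = 1 := by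
  rw [← D.sum_eq_one, ofMatrix]
  refine Finset.sum_congr rfl fun i _ => ?_
  rw [Finset.sum_eq_single i (fun j _ hj => by rw [Matrix.one_apply_ne' hj, zero_smul]) (by simp),
    Matrix.one_apply_eq, one_smul]

theorem ofMatrix_add (M N : Matrix (Fin n) (Fin n) ℂ) :
    D.ofMatrix (M + N) = D.ofMatrix M + D.ofMatrix N := by
  simp only [ofMatrix, Matrix.add_apply, add_smul, Finset.sum_add_distrib]

theorem ofMatrix_star (M : Matrix (Fin n) (Fin n) ℂ) :
    D.ofMatrix (star M) = star (D.ofMatrix M) := by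
  have h : ∀ i j, star (D.v i * star (D.v j)) = D.v j * star (D.v i) := fun i j => by
    rw [star_mul, star_star]
  simp only [ofMatrix, star_sum, star_smul, h, Matrix.star_apply]
  exact Finset.sum_comm

theorem ofMatrix_mul (M N : Matrix (Fin n) (Fin n) ℂ) :
    D.ofMatrix (M * N) = D.ofMatrix M * D.ofMatrix N := by
  have h : ∀ i j k l, D.v i * star (D.v j) * (D.v k * star (D.v l)) =
      if j = k then D.v i * star (D.v l) else 0 := by
    intro i j k l
    rw [mul_assoc, ← mul_assoc (star (D.v j))]
    split_ifs with hjk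
    · rw [hjk, D.star_mul_self, ← mul_assoc, D.mul_p]
    · rw [D.star_mul_of_ne j k hjk, zero_mul, mul_zero]
  have h' : ∀ i j, M i j • (D.v i * star (D.v j)) * D.ofMatrix N =
      ∑ l, (M i j * N j l) • (D.v i * star (D.v l)) := by
    intro i j
    simp only [ofMatrix, Finset.mul_sum, smul_mul_smul_comm, h, smul_ite, smul_zero]
    rw [Finset.sum_comm]
    simp
  rw [ofMatrix, ofMatrix, Finset.sum_mul]
  refine Finset.sum_congr rfl fun i _ => ?_
  simp only [Finset.sum_mul, h', Matrix.mul_apply, Finset.sum_smul]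
  exact Finset.sum_comm

end TypeIFrame

end Matrices

/-! ### The centre and its characters. -/

section Center

open WeakDual

/-- On the character space, take `g = max(0, ε² - ∑ |aᵢ|²)`, which vanishes unless every `|aᵢ| < ε`.
So `ε²|g|² - |aᵢg|²` is nonnegative; written as `star h * h`, this becomes a norm inequality for
operators. -/
theorem exists_bump {B ι : Type*} [CommCStarAlgebra B] [Fintype ι] (χ : characterSpace ℂ B)
    (a : ι → B) (ha : ∀ i, χ (a i) = 0) {ε : ℝ} (hε : 0 < ε) :
    ∃ g : B, χ g ≠ 0 ∧ ∀ i, ∃ h : B,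
      ((ε : ℂ) ^ 2) • (star g * g) - star (a i * g) * (a i * g) = star h * h := by
  let G := gelfandStarTransform B
  have hG : ∀ b : B, ∀ x, G b x = x b := fun b x => rfl
  let k : characterSpace ℂ B → ℝ := fun x => max 0 (ε ^ 2 - ∑ i, ‖G (a i) x‖ ^ 2)
  have hk : Continuous k := by fun_prop
  let g : C(characterSpace ℂ B, ℂ) := ⟨fun x => (k x : ℂ), by fun_prop⟩
  let h : ι → C(characterSpace ℂ B, ℂ) := fun i =>
    ⟨fun x => ((k x * Real.sqrt (max 0 (ε ^ 2 - ‖G (a i) x‖ ^ 2)) : ℝ) : ℂ), by fun_prop⟩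
  refine ⟨G.symm g, ?_, fun i => ⟨G.symm (h i), ?_⟩⟩
  · rw [← hG, G.apply_symm_apply]
    have : k χ = ε ^ 2 := by
      simp only [k, hG, ha, norm_zero]
      simp [hε.le]
    change (k χ : ℂ) ≠ 0
    rw [this]
    exact_mod_cast (pow_pos hε 2).ne'
  · refine EquivLike.injective G ?_
    rw [map_sub, map_smul, map_mul, map_mul, map_star, map_star, map_mul, map_mul, map_star,
      G.apply_symm_apply, G.apply_symm_apply]
    ext x
    have key : k x * k x * (ε ^ 2 - ‖G (a i) x‖ ^ 2) =
        k x * Real.sqrt (max 0 (ε ^ 2 - ‖G (a i) x‖ ^ 2)) *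
          (k x * Real.sqrt (max 0 (ε ^ 2 - ‖G (a i) x‖ ^ 2))) := by
      rw [mul_mul_mul_comm, Real.mul_self_sqrt (le_max_left _ _)]
      by_cases hx : ∑ i, ‖G (a i) x‖ ^ 2 ≤ ε ^ 2
      · have := Finset.single_le_sum (f := fun i => ‖G (a i) x‖ ^ 2) (fun i _ => sq_nonneg _)
          (Finset.mem_univ i)
        rw [max_eq_right (by linarith)]
      · have : k x = 0 := max_eq_left (by linarith)
        rw [this]; simp
    have h2 : star (G (a i) x) * G (a i) x = ((‖G (a i) x‖ ^ 2 : ℝ) : ℂ) := by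
      rw [RCLike.star_def, Complex.conj_mul', Complex.ofReal_pow]
    have h3 : (ε : ℂ) ^ 2 * ((k x : ℂ) * k x) - star (G (a i) x * k x) * (G (a i) x * k x) =
        ((k x * k x * (ε ^ 2 - ‖G (a i) x‖ ^ 2) : ℝ) : ℂ) := by
      push_cast
      push_cast at h2
      rw [mul_sub, ← h2, star_mul', RCLike.star_def, Complex.conj_ofReal]
      ring
    rw [key] at h3
    simpa [g, h] using h3

variable {H : Type*} [NormedAddCommGroup H] [InnerProductSpace ℂ H] [CompleteSpace H]

/-- The centre of a von Neumann algebra. -/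
def center (A : VonNeumannAlgebra H) : StarSubalgebra ℂ (H →L[ℂ] H) :=
  A.toStarSubalgebra ⊓ A.commutant.toStarSubalgebra

theorem mem_center {A : VonNeumannAlgebra H} {T : H →L[ℂ] H} :
    T ∈ A.center ↔ T ∈ A ∧ T ∈ A.commutant := Iff.rfl

instance isClosed_center (A : VonNeumannAlgebra H) : IsClosed (A.center : Set (H →L[ℂ] H)) := by
  have : (A.center : Set (H →L[ℂ] H)) =
      Set.centralizer (Set.centralizer A) ∩ Set.centralizer A := by
    rw [centralizer_centralizer, ← coe_commutant]
    rfl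
  rw [this]
  exact (Set.isClosed_centralizer _).inter (Set.isClosed_centralizer _)

instance (A : VonNeumannAlgebra H) : NormedCommRing A.center :=
  { SubringClass.toNormedRing A.center with
    mul_comm := fun a b => Subtype.ext (mem_commutant_iff.1 b.2.2 a a.2.1) }

instance (A : VonNeumannAlgebra H) : CommCStarAlgebra A.center where
  toCompleteSpace := (isClosed_center A).completeSpace_coe

theorem rangeProj_mem_center {A : VonNeumannAlgebra H} {T : H →L[ℂ] H} (hT : T ∈ A.center) :
    rangeProj T ∈ A.center :=
  mem_center.2 ⟨rangeProj_mem hT.1, rangeProj_mem hT.2⟩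

theorem norm_apply_sq (T : H →L[ℂ] H) (x : H) : ((‖T x‖ : ℂ)) ^ 2 = ⟪(star T * T) x, x⟫_ℂ := by
  rw [mul_apply_eq_comp, ContinuousLinearMap.star_eq_adjoint,
    ContinuousLinearMap.adjoint_inner_left, inner_self_eq_norm_sq_to_K]
  rfl

/-- The range projection `z` of the bump `g` works: `z g = g` and `χ g ≠ 0` force `χ z = 1`, while
`‖aᵢ g y‖ ≤ ε ‖g y‖` extends to the closed range of `g`. -/
theorem exists_centralProj_norm_le {A : VonNeumannAlgebra H} {ι : Type*} [Fintype ι]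
    (χ : characterSpace ℂ A.center) (a : ι → A.center) (ha : ∀ i, χ (a i) = 0) {ε : ℝ}
    (hε : 0 < ε) : ∃ z : A.center, IsStarProjection (z : H →L[ℂ] H) ∧ χ z = 1 ∧
      ∀ i, ‖(a i * z : H →L[ℂ] H)‖ ≤ ε := by
  obtain ⟨g, hg, hgh⟩ := exists_bump χ a ha hε
  have hz : IsStarProjection (rangeProj (g : H →L[ℂ] H)) := isStarProjection_starProjection
  refine ⟨⟨rangeProj g, rangeProj_mem_center g.2⟩, hz, ?_, fun i => ?_⟩
  · have h1 : (⟨rangeProj g, rangeProj_mem_center g.2⟩ : A.center) * g = g := by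
      apply Subtype.ext
      ext x
      exact rangeProj_apply _ x
    have h2 := congrArg χ h1
    rw [map_mul] at h2
    exact mul_right_cancel₀ hg (h2.trans (one_mul _).symm)
  · obtain ⟨h, hh⟩ := hgh i
    have hh' : ((ε : ℂ) ^ 2) • (star (g : H →L[ℂ] H) * g) - star (a i * g : H →L[ℂ] H) * (a i * g) =
        star (h : H →L[ℂ] H) * h := congrArg Subtype.val hh
    have hle : ∀ y, ‖(a i : H →L[ℂ] H) ((g : H →L[ℂ] H) y)‖ ≤ ε * ‖(g : H →L[ℂ] H) y‖ := by
      intro y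
      have h1 := congrArg (fun f : H →L[ℂ] H => ⟪f y, y⟫_ℂ) hh'
      simp only [sub_apply, smul_apply, inner_sub_left, inner_smul_left, map_pow,
        Complex.conj_ofReal, ← norm_apply_sq] at h1
      have h2 : ε ^ 2 * ‖(g : H →L[ℂ] H) y‖ ^ 2 -
          ‖(a i : H →L[ℂ] H) ((g : H →L[ℂ] H) y)‖ ^ 2 = ‖(h : H →L[ℂ] H) y‖ ^ 2 := by
        exact_mod_cast h1
      refine le_of_sq_le_sq ?_ (by positivity)
      rw [mul_pow]
      linarith [sq_nonneg ‖(h : H →L[ℂ] H) y‖]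
    have hle' : ∀ k ∈ (g : H →L[ℂ] H).range.topologicalClosure,
        ‖(a i : H →L[ℂ] H) k‖ ≤ ε * ‖k‖ := by
      intro k hk
      have hcl : IsClosed {k : H | ‖(a i : H →L[ℂ] H) k‖ ≤ ε * ‖k‖} :=
        isClosed_le (by fun_prop) (by fun_prop)
      have hsub : closure (Set.range (g : H →L[ℂ] H)) ⊆
          {k : H | ‖(a i : H →L[ℂ] H) k‖ ≤ ε * ‖k‖} :=
        closure_minimal (by rintro _ ⟨y, rfl⟩; exact hle y) hcl
      exact hsub hk
    refine ContinuousLinearMap.opNorm_le_bound _ hε.le fun x => ?_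
    refine (hle' _ (Submodule.starProjection_apply_mem _ x)).trans ?_
    exact mul_le_mul_of_nonneg_left (norm_apply_le_of_isStarProjection hz x) hε.le

end Center

/-! ### Local cleanness over the centre and gluing. -/

section TypeI

open WeakDual

variable {H : Type*} [NormedAddCommGroup H] [InnerProductSpace ℂ H] [CompleteSpace H]

theorem exists_inverse_mem {A : VonNeumannAlgebra H} {u : H →L[ℂ] H} (hu : u ∈ A)
    (h : IsUnit u) : ∃ b ∈ A, u * b = 1 ∧ b * u = 1 := by
  obtain ⟨b, h1, h2⟩ := isUnit_iff_exists.1 (isUnit_of_isUnit_coe (T := ⟨u, hu⟩) h)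
  exact ⟨b, b.2, congrArg Subtype.val h1, congrArg Subtype.val h2⟩

/-- `T` is `*`-clean in the corner of the central projection `z`. -/
def IsStarCleanAt (A : VonNeumannAlgebra H) (T z : H →L[ℂ] H) : Prop :=
  ∃ P ∈ A, IsStarProjection P ∧ ∃ b ∈ A, z * ((T - P) * b) = z ∧ z * (b * (T - P)) = z

theorem IsStarCleanAt.sup {A : VonNeumannAlgebra H} {T z w : H →L[ℂ] H} (hT : T ∈ A)
    (hz : z ∈ A.center) (hw : w ∈ A.center) (hzp : IsStarProjection z)
    (h : A.IsStarCleanAt T z) (h' : A.IsStarCleanAt T w) :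
    A.IsStarCleanAt T (z + w - z * w) := by
  obtain ⟨P, hPA, hP, b, hb, h1, h2⟩ := h
  obtain ⟨Q, hQA, hQ, c, hc, h3, h4⟩ := h'
  have hzc : ∀ a ∈ A, a * z = z * a := fun a ha => mem_commutant_iff.1 hz.2 a ha
  have zz : z * z = z := hzp.isIdempotentElem
  obtain ⟨y, hy⟩ : ∃ y, y = 1 - z := ⟨_, rfl⟩
  have hyc : ∀ a ∈ A, a * y = y * a := fun a ha => by
    rw [hy, mul_sub, sub_mul, hzc a ha, one_mul, mul_one]
  have hyA : y ∈ A := hy ▸ sub_mem (one_mem A) hz.1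
  have yy : y * y = y := hy ▸ hzp.one_sub.isIdempotentElem
  have hyp : IsStarProjection y := hy ▸ hzp.one_sub
  have zy : z * y = 0 := by rw [hy]; exact hzp.mul_one_sub_self
  have yz : y * z = 0 := by rw [hy]; exact hzp.one_sub_mul_self
  -- On `z` the first decomposition is kept, on the disjoint rest `(1 - z)w` the second is used.
  have hsum : z + w - z * w = z + y * w := by rw [hy, sub_mul, one_mul]; abel
  have hwc : ∀ a ∈ A, a * w = w * a := fun a ha => mem_commutant_iff.1 hw.2 a ha
  have key : ∀ a ∈ A, ∀ b ∈ A, ∀ c ∈ A, ∀ d ∈ A,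
      (z * a + y * c) * (z * b + y * d) = z * (a * b) + y * (c * d) := by
    intro a ha b hb c hc d hd
    have e1 : z * a * (z * b) = z * (a * b) := by
      rw [mul_assoc, ← mul_assoc a, hzc a ha, mul_assoc z a, ← mul_assoc z z, zz]
    have e2 : z * a * (y * d) = 0 := by
      rw [mul_assoc, ← mul_assoc a, hyc a ha, mul_assoc y a, ← mul_assoc z y, zy, zero_mul]
    have e3 : y * c * (z * b) = 0 := by
      rw [mul_assoc, ← mul_assoc c, hzc c hc, mul_assoc z c, ← mul_assoc y z, yz, zero_mul]
    have e4 : y * c * (y * d) = y * (c * d) := by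
      rw [mul_assoc, ← mul_assoc c, hyc c hc, mul_assoc y c, ← mul_assoc y y, yy]
    rw [add_mul, mul_add, mul_add, e1, e2, e3, e4, add_zero, zero_add]
  have hTP : T - (z * P + y * Q) = z * (T - P) + y * (T - Q) := by
    rw [hy]; noncomm_ring
  have fin : ∀ a ∈ A, ∀ c ∈ A, z * a = z → w * c = w →
      (z + y * w) * (z * a + y * c) = z + y * w := by
    intro a ha c hc e1 e2
    have := key 1 (one_mem A) a ha w hw.1 c hc
    rw [mul_one, one_mul] at this
    rw [this, e1, e2]
  refine ⟨z * P + y * Q, add_mem (mul_mem hz.1 hPA) (mul_mem hyA hQA), ⟨?_, ?_⟩, z * b + y * c,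
    add_mem (mul_mem hz.1 hb) (mul_mem hyA hc), ?_, ?_⟩
  · rw [IsIdempotentElem, key P hPA P hPA Q hQA Q hQA, hP.isIdempotentElem.eq,
      hQ.isIdempotentElem.eq]
  · rw [IsSelfAdjoint, star_add, star_mul, star_mul, hP.isSelfAdjoint.star_eq,
      hQ.isSelfAdjoint.star_eq, hzp.isSelfAdjoint.star_eq, hyp.isSelfAdjoint.star_eq, hzc P hPA,
      hyc Q hQA]
  · rw [hsum, hTP, key _ (sub_mem hT hPA) _ hb _ (sub_mem hT hQA) _ hc]
    exact fin _ (mul_mem (sub_mem hT hPA) hb) _ (mul_mem (sub_mem hT hQA) hc) h1 h3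
  · rw [hsum, hTP, key _ hb _ (sub_mem hT hPA) _ hc _ (sub_mem hT hQA)]
    exact fin _ (mul_mem hb (sub_mem hT hPA)) _ (mul_mem hc (sub_mem hT hQA)) h2 h4

namespace TypeIFrame

variable {A : VonNeumannAlgebra H} {n : ℕ} (D : A.TypeIFrame n)

/-- The entries of `T` with respect to the matrix units, as elements of the centre. -/
def entry (T : H →L[ℂ] H) (i j : Fin n) : H →L[ℂ] H :=
  ∑ r, D.v r * (star (D.v i) * T * D.v j) * star (D.v r)

/-- The entry is a constant diagonal matrix. It commutes with `S` because `star (v i) * T * v j`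
commutes with every `star (v a) * S * v b`, all of them lying in the commutative corner. -/
theorem entry_mem_center {T : H →L[ℂ] H} (hT : T ∈ A) (i j : Fin n) :
    D.entry T i j ∈ A.center := by
  refine mem_center.2 ⟨sum_mem fun r _ => mul_mem (mul_mem (D.v_mem r) (mul_mem (mul_mem
    (star_mem (D.v_mem i)) hT) (D.v_mem j))) (star_mem (D.v_mem r)), mem_commutant_iff.2 ?_⟩
  intro S hS
  have h1 : S * D.entry T i j = ∑ a, ∑ b, D.v a * (star (D.v a) * S * D.v b *
      (star (D.v i) * T * D.v j)) * star (D.v b) := by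
    rw [← one_mul (S * _), ← D.sum_eq_one, entry, Finset.mul_sum, Finset.sum_mul]
    simp only [Finset.mul_sum, mul_assoc]
  have h2 : D.entry T i j * S = ∑ a, ∑ b, D.v a * (star (D.v i) * T * D.v j *
      (star (D.v a) * S * D.v b)) * star (D.v b) := by
    rw [← mul_one (_ * S), ← D.sum_eq_one, entry, Finset.sum_mul, Finset.sum_mul]
    simp only [Finset.mul_sum, mul_assoc]
  rw [h1, h2]
  exact Finset.sum_congr rfl fun a _ => Finset.sum_congr rfl fun b _ => by
    rw [D.comm a b i j S hS T hT]

theorem eq_sum_entry (T : H →L[ℂ] H) :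
    T = ∑ i, ∑ j, D.v i * star (D.v j) * D.entry T i j := by
  have h : ∀ i j, D.v i * star (D.v j) * D.entry T i j =
      D.v i * star (D.v i) * T * (D.v j * star (D.v j)) := by
    intro i j
    rw [entry, Finset.mul_sum, Finset.sum_eq_single j]
    · have e1 : D.v i * star (D.v j) * (D.v j * (star (D.v i) * T * D.v j) * star (D.v j)) =
          D.v i * (star (D.v j) * D.v j) * (star (D.v i) * T * D.v j) * star (D.v j) := by
        simp only [mul_assoc]
      rw [e1, D.star_mul_self, D.mul_p]
      simp only [mul_assoc]
    · intro r _ hr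
      have e1 : D.v i * star (D.v j) * (D.v r * (star (D.v i) * T * D.v j) * star (D.v r)) =
          D.v i * (star (D.v j) * D.v r) * (star (D.v i) * T * D.v j) * star (D.v r) := by
        simp only [mul_assoc]
      rw [e1, D.star_mul_of_ne j r hr.symm, mul_zero, zero_mul, zero_mul]
    · simp
  simp only [h, ← Finset.mul_sum, ← Finset.sum_mul, D.sum_eq_one, one_mul, mul_one]

/-- The scalar matrix `M` of values of `χ` on the entries decomposes as `U + P`. Where the entries
are close to their values at `χ`, `T - P` is close to the lift of `U`, hence invertible. -/
theorem exists_isStarCleanAt (D : A.TypeIFrame n) {T : H →L[ℂ] H} (hT : T ∈ A) (χ : characterSpace ℂ A.center) :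
    ∃ z : A.center, IsStarProjection (z : H →L[ℂ] H) ∧ χ z = 1 ∧ A.IsStarCleanAt T z := by
  let τ : Fin n × Fin n → A.center := fun x => ⟨D.entry T x.1 x.2, D.entry_mem_center hT x.1 x.2⟩
  let M : Matrix (Fin n) (Fin n) ℂ := fun i j => χ (τ (i, j))
  obtain ⟨U, P, hU, hP, hM⟩ := isStarCleanElem_matrix M
  have hUu : IsUnit (D.ofMatrix U) := by
    obtain ⟨V, h1, h2⟩ := isUnit_iff_exists.1 hU
    exact isUnit_iff_exists.2 ⟨D.ofMatrix V, by rw [← ofMatrix_mul, h1, ofMatrix_one],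
      by rw [← ofMatrix_mul, h2, ofMatrix_one]⟩
  obtain ⟨r, hr, hball⟩ := Metric.isOpen_iff.1 (Units.isOpen (R := H →L[ℂ] H)) _ hUu
  obtain ⟨C, hC⟩ : ∃ C, C = ∑ i, ∑ j, ‖D.v i * star (D.v j)‖ := ⟨_, rfl⟩
  have hC0 : 0 ≤ C := hC ▸ Finset.sum_nonneg fun i _ => Finset.sum_nonneg fun j _ => norm_nonneg _
  -- The tolerance `r / (C + 1)` makes `‖R z‖ ≤ C r / (C + 1) < r`, also when `C = 0`.
  obtain ⟨z, hz, hχ, hn⟩ := exists_centralProj_norm_le χ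
    (fun x => τ x - algebraMap ℂ A.center (χ (τ x)))
    (fun x => by rw [map_sub, AlgHomClass.commutes, Algebra.algebraMap_self, RingHom.id_apply,
      sub_self]) (ε := r / (C + 1)) (by positivity)
  refine ⟨z, hz, hχ, D.ofMatrix P, D.ofMatrix_mem P, ⟨?_, ?_⟩, ?_⟩
  · rw [IsIdempotentElem, ← ofMatrix_mul, hP.isIdempotentElem.eq]
  · rw [IsSelfAdjoint, ← ofMatrix_star, hP.isSelfAdjoint.star_eq]
  have hzA : (z : H →L[ℂ] H) ∈ A := z.2.1
  have hzc : ∀ a ∈ A, a * (z : H →L[ℂ] H) = z * a := fun a ha => mem_commutant_iff.1 z.2.2 a ha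
  have zz : (z : H →L[ℂ] H) * z = z := hz.isIdempotentElem
  obtain ⟨R, hR⟩ : ∃ R, R = T - D.ofMatrix M := ⟨_, rfl⟩
  have hRA : R ∈ A := hR ▸ sub_mem hT (D.ofMatrix_mem M)
  have hRz : ‖R * z‖ < r := by
    have h1 : R * z = ∑ i, ∑ j, D.v i * star (D.v j) *
        (((τ (i, j) - algebraMap ℂ A.center (χ (τ (i, j))) : A.center) : H →L[ℂ] H) * z) := by
      rw [hR]
      nth_rw 1 [D.eq_sum_entry T]
      rw [ofMatrix, ← Finset.sum_sub_distrib, Finset.sum_mul]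
      refine Finset.sum_congr rfl fun i _ => ?_
      rw [← Finset.sum_sub_distrib, Finset.sum_mul]
      refine Finset.sum_congr rfl fun j _ => ?_
      rw [← mul_assoc]
      congr 1
      change _ = D.v i * star (D.v j) * (D.entry T i j - algebraMap ℂ (H →L[ℂ] H) (M i j))
      rw [mul_sub, Algebra.algebraMap_eq_smul_one, mul_smul_comm, mul_one]
    calc ‖R * z‖ ≤ ∑ i, ∑ j, ‖D.v i * star (D.v j)‖ * (r / (C + 1)) := by
          rw [h1]
          refine norm_sum_le_of_le _ fun i _ => norm_sum_le_of_le _ fun j _ => ?_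
          exact (norm_mul_le _ _).trans (mul_le_mul_of_nonneg_left (hn (i, j)) (norm_nonneg _))
      _ = C * (r / (C + 1)) := by simp only [← Finset.sum_mul, hC]
      _ < r := by
          rw [mul_div_assoc', div_lt_iff₀ (by positivity)]
          nlinarith
  have hu : IsUnit (D.ofMatrix U + R * z) := hball (by
    rw [Metric.mem_ball, dist_eq_norm, add_sub_cancel_left]
    exact hRz)
  obtain ⟨b, hb, h1, h2⟩ := exists_inverse_mem (add_mem (D.ofMatrix_mem U) (mul_mem hRA hzA)) hu
  -- Only `R z` is small, so `U + R z` is inverted on the whole space; multiplied by `z` it agrees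
  -- with `T - P`.
  have hTP : (z : H →L[ℂ] H) * (T - D.ofMatrix P) = z * (D.ofMatrix U + R * z) := by
    have : T - D.ofMatrix P = D.ofMatrix U + R := by
      rw [hR, hM, ofMatrix_add]
      abel
    rw [this, mul_add, mul_add, hzc R hRA, ← mul_assoc (z : H →L[ℂ] H) z, zz]
  refine ⟨b, hb, ?_, ?_⟩
  · rw [← mul_assoc, hTP, mul_assoc, h1, mul_one]
  · rw [← mul_assoc, ← hzc b hb, mul_assoc, hTP, ← mul_assoc, hzc b hb, mul_assoc, h2, mul_one]

theorem isStarCleanRing (D : A.TypeIFrame n) : IsStarCleanRing A := by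
  intro T
  have hone : ∀ (χ : characterSpace ℂ A.center) {z : A.center}, IsStarProjection (z : H →L[ℂ] H) →
      χ z ≠ 0 → χ z = 1 := by
    intro χ z hz h0
    have h1 : z * z = z := Subtype.ext hz.isIdempotentElem.eq
    have h2 := congrArg χ h1
    rw [map_mul] at h2
    exact mul_right_cancel₀ h0 (h2.trans (one_mul _).symm)
  -- A character takes only the values `0` and `1` on a projection, so `{χ | χ z = 1}` is the open
  -- set `{χ | χ z ≠ 0}`. Compactness yields one `z` with value `1` at every character, hence `z =
  -- 1`.
  obtain ⟨z, hz, hT, hχ⟩ := isCompact_univ.induction_on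
    (s := (Set.univ : Set (characterSpace ℂ A.center)))
    (p := fun S => ∃ z : A.center, IsStarProjection (z : H →L[ℂ] H) ∧
      A.IsStarCleanAt (T : H →L[ℂ] H) z ∧ ∀ χ ∈ S, χ z = 1)
    ⟨0, .zero _, ⟨0, zero_mem _, .zero _, 0, zero_mem _, by simp, by simp⟩, fun _ h => h.elim⟩
    (fun S S' hS ⟨z, h1, h2, h3⟩ => ⟨z, h1, h2, fun χ hχ => h3 χ (hS hχ)⟩)
    (fun S S' ⟨z, h1, h2, h3⟩ ⟨w, h4, h5, h6⟩ => ⟨z + w - z * w,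
      h1.add_sub_mul_of_commute (mem_commutant_iff.1 w.2.2 z z.2.1) h4,
      h2.sup T.2 z.2 w.2 h1 h5, fun χ hχ => by
        rw [map_sub, map_add, map_mul]
        rcases hχ with h | h
        · rw [h3 χ h]; ring
        · rw [h6 χ h]; ring⟩)
    (fun χ _ => by
      obtain ⟨z, h1, h2, h3⟩ := D.exists_isStarCleanAt T.2 χ
      refine ⟨{ψ | ψ z ≠ 0}, mem_nhdsWithin_of_mem_nhds (IsOpen.mem_nhds ?_ ?_), z, h1, h3,
        fun ψ hψ => hone ψ h1 hψ⟩
      · exact isOpen_ne_fun (gelfandTransform ℂ A.center z).continuous continuous_const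
      · rw [Set.mem_ofPred_eq, h2]
        exact one_ne_zero)
  have hz1 : z = 1 := (gelfandTransform_isometry A.center).injective (by
    ext χ
    rw [map_one]
    exact hχ χ trivial)
  rw [hz1] at hT
  obtain ⟨P, hPA, hP, b, hb, h1, h2⟩ := hT
  refine ⟨T - ⟨P, hPA⟩, ⟨P, hPA⟩, isUnit_iff_exists.2 ⟨⟨b, hb⟩, Subtype.ext ?_, Subtype.ext ?_⟩,
    ⟨Subtype.ext hP.isIdempotentElem.eq, Subtype.ext hP.isSelfAdjoint.star_eq⟩,
    (sub_add_cancel _ _).symm⟩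
  · exact (one_mul _).symm.trans h1
  · exact (one_mul _).symm.trans h2

end TypeIFrame

end TypeI

/-! ### Finite direct sums, componentwise. -/

section DirectSumClean

variable {ι : Type*} [Fintype ι] {H : ι → Type*} [∀ i, NormedAddCommGroup (H i)]
  [∀ i, InnerProductSpace ℂ (H i)] [∀ i, CompleteSpace (H i)]

theorem isStarCleanRing_directSum {A : ∀ i, VonNeumannAlgebra (H i)}
    (hA : ∀ i, IsStarCleanRing (A i)) : IsStarCleanRing (directSum A) := by
  rintro ⟨_, t, ht, rfl⟩
  choose u p hu hp h using fun i => hA i ⟨t i, ht i⟩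
  choose w hw hw' using fun i => isUnit_iff_exists.1 (hu i)
  refine ⟨⟨blockDiag fun i => u i, _, fun i => (u i).2, rfl⟩,
    ⟨blockDiag fun i => p i, _, fun i => (p i).2, rfl⟩,
    isUnit_iff_exists.2 ⟨⟨blockDiag fun i => w i, _, fun i => (w i).2, rfl⟩, Subtype.ext ?_,
      Subtype.ext ?_⟩, ⟨Subtype.ext ?_, Subtype.ext ?_⟩, Subtype.ext ?_⟩
  · ext x i
    exact congrArg (fun f : A i => (f : H i →L[ℂ] H i) (x i)) (hw i)
  · ext x i
    exact congrArg (fun f : A i => (f : H i →L[ℂ] H i) (x i)) (hw' i)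
  · ext x i
    exact congrArg (fun f : A i => (f : H i →L[ℂ] H i) (x i)) (hp i).isIdempotentElem.eq
  · refine (star_blockDiag _).trans ?_
    congr 1
    ext i : 1
    exact congrArg Subtype.val (hp i).isSelfAdjoint.star_eq
  · ext x i
    exact congrArg (fun f : A i => (f : H i →L[ℂ] H i) (x i)) (h i)

end DirectSumClean

end VonNeumannAlgebra

end

theorem mainTheorem6 :
    -- every operator with closed range in a finite von Neumann algebra is `*`-clean, through the
    -- projection attached to any normal form of `I - 𝒦(T)` and `ℛ(T)`, and such a form exists
    (∀ (H : Type*) [NormedAddCommGroup H] [InnerProductSpace ℂ H] [CompleteSpace H]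
        (A : VonNeumannAlgebra H), A.IsFiniteAlg →
        ∀ T : A, IsClosed (Set.range (T : H →L[ℂ] H)) →
          IsStarCleanElem T ∧
          Nonempty (A.TwoProjForm (1 - VonNeumannAlgebra.kerProj (T : H →L[ℂ] H))
            (VonNeumannAlgebra.rangeProj (T : H →L[ℂ] H))) ∧
          ∀ D : A.TwoProjForm (1 - VonNeumannAlgebra.kerProj (T : H →L[ℂ] H))
              (VonNeumannAlgebra.rangeProj (T : H →L[ℂ] H)),
            ∃ Q : A, (Q : H →L[ℂ] H) = D.P ∧ IsStarProjection Q ∧ IsUnit (T - Q)) ∧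
    -- finite direct sums of von Neumann algebras of type `I_n` are `*`-clean
    (∀ (ι : Type*) [Fintype ι] (H : ι → Type*) [∀ i, NormedAddCommGroup (H i)]
        [∀ i, InnerProductSpace ℂ (H i)] [∀ i, CompleteSpace (H i)]
        (A : ∀ i, VonNeumannAlgebra (H i)) (n : ι → ℕ), (∀ i, (A i).IsTypeI (n i)) →
        IsStarCleanRing (VonNeumannAlgebra.directSum A)) := by
  refine ⟨fun H _ _ _ A hA T hT => ⟨VonNeumannAlgebra.isStarCleanElem_of_isClosed_range hA T hT,
    VonNeumannAlgebra.nonempty_twoProjForm hA T.2, fun D =>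
      VonNeumannAlgebra.exists_isStarProjection_isUnit_sub T hT D⟩, ?_⟩
  intro ι _ H _ _ _ A n hA
  exact VonNeumannAlgebra.isStarCleanRing_directSum fun i =>
    (hA i).nonempty_typeIFrame.elim fun D => D.isStarCleanRing
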